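/- Let $\Sigma$ be a closed surface (a compact $2$-manifold without boundary), let $G=(V,E)$ be a finite graph without loops (multiple edges allowed), and let $\eta$ be a closed $2$-cell embedding of $G$ in $\Sigma$: an embedding such that, for every face (connected component of the complement of the embedded graph), the closure of the face is homeomorphic to a closed disk and the face is bounded by a simple closed curve consisting of edges. Let $\Phi\in(0,\frac{\pi}{2}]^E$ be intersection angles and $\hat L\in(0,\infty)^V$ prescribed total geodesic curvatures. For radii $r\in(0,\frac{\pi}{2})^V$ and an edge $e$ with ends $v,w$ let $\tilde Q_e$ be the spherical quadrilateral $v\,f_1\,w\,f_2$ with $|vf_1|=|vf_2|=r_v$, $|wf_1|=|wf_2|=r_w$ and angles $\pi-\Phi(e)$ at $f_1$ and $f_2$, and let $\theta_{(e,v)}$ be its angle at $v$. Gluing the quadrilaterals $\tilde Q_e$ according to $\eta$ gives a spherical cone metric on $\Sigma$ with cone angle $\alpha_v=\sum_{e\ni v}\theta_{(e,v)}$ at $v$; the ideal circle pattern with radii $r$ consists of the circles $C_v$ with centre $v$ and radius $r_v$ in this metric. The circle $C_v$ has geodesic curvature $\cot r_v$, circumference $\alpha_v\sin r_v$ and total geodesic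 curvature $$L_v=L_v(r)=\alpha_v\cos r_v .$$ Put $K_v=\ln\cot r_v$ (a bijection $(0,\frac{\pi}{2})^V\to\mathbb R^V$), regard $L=(L_v)_{v\in V}$ as a function of $K\in\mathbb R^V$, and let $J=\left(\partial L_v/\partial K_w\right)_{v,w\in V}$. For $W\subset V$ let $E(W)$ be the set of edges with at least one end in $W$. Then for every $K_0\in\mathbb R^V$ the combinatorial Calabi flow $$\frac{dK}{dt}=-J^T(L-\hat L),\qquad K(0)=K_0,$$ has a unique solution, and this solution exists for all time $t\in\mathbb R$. Moreover, the following statements are equivalent: (i) The combinatorial Calabi flow converges (in $\mathbb R^V$, as $t\to+\infty$) for every initial datum $K(0)\in\mathbb R^V$. (ii) The prescribed curvature flow $$\frac{dr_v}{dt}=\frac{L_v-\hat L_v}{2}\,\sin 2r_v,\qquad v\in V,$$ in $(0,\frac{\pi}{2})^V$ converges for every initial datum $r(0)\in(0,\frac{\pi}{2})^V$, that is, it has a solution for all $t\ge 0$, which converges to a point of $(0,\frac{\pi}{2})^V$ as $t\to+\infty$. (iii) $\displaystyle\sum_{v\in W}\hat L_v<2\sum_{e\in E(W)}\Phi(e)$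 for every nonempty $W\subset V$. Finally, if a solution $K(t)$, $t\ge 0$, of the combinatorial Calabi flow converges, then there is a unique $r\in(0,\frac{\pi}{2})^V$, that is, a unique ideal circle pattern, with $L_v(r)=\hat L_v$ for all $v\in V$, and $K(t)$ converges exponentially fast to $\ln\cot r$: there are constants $C$ and $c>0$, which may depend on the solution, such that $\|K(t)-\ln\cot r\|\le Ce^{-ct}$ for all $t\ge 0$. -/

import Mathlib

open Set Filter Topology
open scoped Graph

noncomputable section

/-! ### Graphs embedded in surfaces -/

/-- An embedding in a topological space `S` of a multigraph `G`: distinct vertices go to distinct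
points, every edge goes to a simple arc joining its two ends, and the arcs meet the vertices and
one another only at their end points. -/
structure GraphEmbedding {α β : Type*} (G : Graph α β) (S : Type*) [TopologicalSpace S] where
  vert : V(G) → S
  edge : E(G) → C(unitInterval, S)
  vert_injective : Function.Injective vert
  edge_injective : ∀ e : E(G), Function.Injective (edge e)
  edge_ends : ∀ e : E(G), ∃ v w : V(G), G.IsLink e v w ∧ edge e 0 = vert v ∧ edge e 1 = vert w
  edge_ne_vert : ∀ e : E(G), ∀ s ∈ Ioo (0 : unitInterval) 1, ∀ v : V(G), edge e s ≠ vert v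
  edge_disjoint : ∀ e e' : E(G), ∀ s ∈ Ioo (0 : unitInterval) 1, ∀ s' ∈ Ioo (0 : unitInterval) 1,
    edge e s = edge e' s' → e = e'

namespace GraphEmbedding

variable {α β : Type*} {G : Graph α β} {S : Type*} [TopologicalSpace S]

/-- The image in `S` of the embedded graph. -/
def image (η : GraphEmbedding G S) : Set S := range η.vert ∪ ⋃ e, range (η.edge e)

/-- A face is a connected component of the complement of the embedded graph. -/
def IsFace (η : GraphEmbedding G S) (f : Set S) : Prop :=
  ∃ x ∈ η.imageᶜ, f = connectedComponentIn η.imageᶜ x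

/-- Closed 2-cell embeddings: the closure of every face is homeomorphic to a closed disk, and
every face is bounded by a simple closed curve made up of edges. Multiple edges and faces bounded
by two edges are allowed. -/
structure IsClosedTwoCell (η : GraphEmbedding G S) : Prop where
  closure_disk : ∀ f, η.IsFace f →
    Nonempty (closure f ≃ₜ Metric.closedBall (0 : EuclideanSpace ℝ (Fin 2)) 1)
  boundary_curve : ∀ f, η.IsFace f →
    ∃ (γ : C(Circle, S)) (A : Set E(G)), Function.Injective γ ∧
      frontier f = range γ ∧ frontier f = ⋃ e ∈ A, range (η.edge e)

end GraphEmbedding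

/-! ### Spherical geometry -/

/-- The point of the unit sphere of `ℝ³` at spherical distance `ρ` from the north pole, in the
direction of longitude `φ`. -/
def spherePoint (ρ φ : ℝ) : EuclideanSpace ℝ (Fin 3) :=
  !₂[Real.sin ρ * Real.cos φ, Real.sin ρ * Real.sin φ, Real.cos ρ]

/-- The component of `q` orthogonal to the unit vector `p`: a tangent vector at `p` of the minimal
geodesic from `p` to `q`. -/
def tangentDir (p q : EuclideanSpace ℝ (Fin 3)) : EuclideanSpace ℝ (Fin 3) :=
  q - inner ℝ p q • p

/-- The angle at `p` between the minimal spherical geodesics from `p` to `q` and to `s`. -/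
def sphereAngle (q p s : EuclideanSpace ℝ (Fin 3)) : ℝ :=
  InnerProductGeometry.angle (tangentDir p q) (tangentDir p s)

/-- The angle at `v` of the spherical quadrilateral `v f₁ w f₂` with angles `π - φ` at `f₁` and
`f₂` and side lengths `|v f₁| = |v f₂| = a`, `|w f₁| = |w f₂| = b`. The diagonal `v w` cuts it
into two mirror-symmetric triangles, so the angle at `v` is twice the angle at `v` of the triangle
`v f w` with sides `a`, `b` enclosing the angle `π - φ` at `f`. That triangle is placed with `f`
at the north pole. -/
def kiteAngle (φ a b : ℝ) : ℝ :=
  2 * sphereAngle (spherePoint 0 0) (spherePoint a 0) (spherePoint b (Real.pi - φ))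

theorem inner_spherePoint (ρ φ ρ' φ' : ℝ) :
    inner ℝ (spherePoint ρ φ) (spherePoint ρ' φ') =
      Real.sin ρ * Real.sin ρ' * Real.cos (φ - φ') + Real.cos ρ * Real.cos ρ' := by
  simp [spherePoint, PiLp.inner_apply, Fin.sum_univ_three, Real.cos_sub]
  ring

theorem norm_spherePoint (ρ φ : ℝ) : ‖spherePoint ρ φ‖ = 1 := by
  have h : ‖spherePoint ρ φ‖ ^ 2 = 1 := by
    rw [← real_inner_self_eq_norm_sq, inner_spherePoint]
    have := Real.sin_sq_add_cos_sq ρ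
    simp only [sub_self, Real.cos_zero]
    nlinarith
  have h0 := norm_nonneg (spherePoint ρ φ)
  nlinarith

/-- `spherePoint ρ φ` lies at spherical distance `ρ` from the north pole. -/
theorem angle_pole_spherePoint {ρ : ℝ} (h0 : 0 ≤ ρ) (hπ : ρ ≤ Real.pi) (φ : ℝ) :
    InnerProductGeometry.angle (spherePoint 0 0) (spherePoint ρ φ) = ρ := by
  simp [InnerProductGeometry.angle, norm_spherePoint, inner_spherePoint, Real.arccos_cos h0 hπ]

/-- In the model triangle the angle at the north pole is `ψ`. -/
theorem sphereAngle_pole {a b ψ : ℝ} (ha : a ∈ Ioo 0 Real.pi) (hb : b ∈ Ioo 0 Real.pi)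
    (h0 : 0 ≤ ψ) (hπ : ψ ≤ Real.pi) :
    sphereAngle (spherePoint a 0) (spherePoint 0 0) (spherePoint b ψ) = ψ := by
  have key : ∀ c χ : ℝ, tangentDir (spherePoint 0 0) (spherePoint c χ) =
      Real.sin c • spherePoint (Real.pi / 2) χ := by
    intro c χ
    unfold tangentDir
    rw [inner_spherePoint]
    ext i
    fin_cases i <;> simp [spherePoint]
  rw [sphereAngle, key, key,
    InnerProductGeometry.angle_smul_left_of_pos _ _ (Real.sin_pos_of_mem_Ioo ha),
    InnerProductGeometry.angle_smul_right_of_pos _ _ (Real.sin_pos_of_mem_Ioo hb)]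
  simp [InnerProductGeometry.angle, norm_spherePoint, inner_spherePoint, Real.arccos_cos h0 hπ]

/-! ### Ideal circle patterns

For a fixed embedding and fixed intersection angles `Φ`, an ideal circle pattern is given by its
radii `r v ∈ (0, π / 2)`: the surface is glued from the quadrilaterals of the edges, and the
circle `C_v` is centred at the (cone) point `v` and has radius `r v`. -/

section Pattern

variable {α β : Type*} {G : Graph α β}

/-- The radii of ideal circle patterns. -/
def radiiDomain (G : Graph α β) : Set (V(G) → ℝ) := {r | ∀ v, r v ∈ Ioo 0 (Real.pi / 2)}

variable [Fintype V(G)] [Fintype E(G)]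

open scoped Classical in
/-- The cone angle at `v`: the sum, over the edges `e` at `v`, of the angle at `v` of the
quadrilateral of `e`. The inner sum has one nonzero term, that of the other end `w` of `e`. -/
def coneAngle (Φ : E(G) → ℝ) (r : V(G) → ℝ) (v : V(G)) : ℝ :=
  ∑ e : E(G), ∑ w : V(G), if G.IsLink e v w then kiteAngle (Φ e) (r v) (r w) else 0

/-- The circumference of the circle `C_v`. -/
def circumference (Φ : E(G) → ℝ) (r : V(G) → ℝ) (v : V(G)) : ℝ :=
  coneAngle Φ r v * Real.sin (r v)

/-- The total geodesic curvature `L_v` of the circle `C_v`, whose geodesic curvature is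
`cot (r v)`. -/
def totalCurvature (Φ : E(G) → ℝ) (r : V(G) → ℝ) (v : V(G)) : ℝ :=
  Real.cot (r v) * circumference Φ r v

open scoped Classical in
/-- `E(W)`: the edges that have at least one end point in `W`. -/
def edgesMeeting (W : Finset V(G)) : Finset E(G) :=
  Finset.univ.filter fun e => ∃ v ∈ W, G.Inc e v

end Pattern

/-! ### Logarithmic coordinates -/

section Coordinates

variable {ι : Type*}

/-- The change of coordinates `K_v = ln cot r_v`. -/
def logCot (r : ι → ℝ) : ι → ℝ := fun v => Real.log (Real.cot (r v))

/-- The inverse change of coordinates. -/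
def radiusOf (K : ι → ℝ) : ι → ℝ := fun v => Real.arctan (Real.exp (-K v))

theorem radiusOf_mem (K : ι → ℝ) (v : ι) : radiusOf K v ∈ Ioo 0 (Real.pi / 2) :=
  ⟨Real.arctan_pos.2 (Real.exp_pos _), Real.arctan_lt_pi_div_two _⟩

theorem logCot_radiusOf (K : ι → ℝ) : logCot (radiusOf K) = K := by
  funext v
  simp [logCot, radiusOf, ← Real.tan_inv_eq_cot, Real.tan_arctan, ← Real.exp_neg]

theorem radiusOf_logCot {r : ι → ℝ} (h : ∀ v, r v ∈ Ioo 0 (Real.pi / 2)) :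
    radiusOf (logCot r) = r := by
  funext v
  obtain ⟨h0, h1⟩ := h v
  have ht : 0 < Real.tan (r v) := Real.tan_pos_of_pos_of_lt_pi_div_two h0 h1
  simp only [logCot, radiusOf, ← Real.tan_inv_eq_cot, Real.log_inv, neg_neg, Real.exp_log ht]
  exact Real.arctan_tan (by linarith) h1

end Coordinates

/-! ### The flows -/

section Flow

variable {α β : Type*} {G : Graph α β} [Fintype V(G)] [Fintype E(G)]

open scoped Classical in
/-- The Jacobi matrix `J = (∂L_v / ∂K_w)` at `K`. -/
def jacobi (Φ : E(G) → ℝ) (K : V(G) → ℝ) : Matrix V(G) V(G) ℝ :=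
  Matrix.of fun v w =>
    deriv (fun s => totalCurvature Φ (radiusOf (Function.update K w s)) v) (K w)

/-- The vector field `-Jᵀ (L - L̂)` of the combinatorial Calabi flow, in the coordinates `K`. -/
def calabiField (Φ : E(G) → ℝ) (Lhat K : V(G) → ℝ) : V(G) → ℝ :=
  -((jacobi Φ K).transpose.mulVec (totalCurvature Φ (radiusOf K) - Lhat))

/-- The vector field of the prescribed curvature flow `dr_v/dt = (L_v - L̂_v) / 2 * sin (2 r_v)`. -/
def curvatureField (Φ : E(G) → ℝ) (Lhat r : V(G) → ℝ) : V(G) → ℝ :=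
  fun v => (totalCurvature Φ r v - Lhat v) / 2 * Real.sin (2 * r v)

variable {ι : Type*} [Fintype ι]

/-- `x` solves `dx/dt = X(x)` in the domain `D` on the time interval `T`. -/
def IsSolutionOn (X : (ι → ℝ) → ι → ℝ) (D : Set (ι → ℝ)) (T : Set ℝ) (x : ℝ → ι → ℝ) : Prop :=
  ∀ t ∈ T, x t ∈ D ∧ HasDerivWithinAt x (X (x t)) T t

/-- The flow `dx/dt = X(x)` in the domain `D` converges for every initial datum: it has a solution
on `[0, ∞)`, and any such solution converges to a point of `D` as `t → ∞`. -/
def FlowConverges (X : (ι → ℝ) → ι → ℝ) (D : Set (ι → ℝ)) : Prop :=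
  ∀ x₀ ∈ D, (∃ x, IsSolutionOn X D (Ici 0) x ∧ x 0 = x₀) ∧
    ∀ x, IsSolutionOn X D (Ici 0) x → x 0 = x₀ → ∃ y ∈ D, Tendsto x atTop (𝓝 y)

end Flow

end

/-! In the coordinates `K` each edge contributes `sector φ k l` to one end and `sector φ l k` to the
other. Its mixed partial derivatives are equal and negative (`sectorOff_comm`, `sectorOff_pos`), and
moving both logarithmic radii together increases each contribution (`sectorExcess_pos`). Hence the
Jacobian of `curvatureMap` is symmetric, and its quadratic form is a sum over edges of positive
multiples of `a v ^ 2` and `(a v - a w) ^ 2`. It is positive definite, since a closed 2-cell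
embedding has no isolated vertices. So `L - L̂` is the gradient of a strictly convex potential, and
`L` is injective.

The image of `L` is the polytope cut out by positivity and the inequalities in (iii)
(`range_curvatureMap`). The strict bounds hold because an edge contributes less than `2φ` in total,
the value attained by a Euclidean triangle in the limit. The image is open by the inverse function
theorem. It is closed in the polytope: if some `K v` tend to infinity, the inequality for the set of
those `v` fails in the limit, while `K v → -∞` forces `L v → 0`. Convexity of the polytope then
makes it equal to the image.

In these coordinates both flows are descent flows `dK/dt = -M (L - L̂)` with `M` positive definite:
`M = J` for the Calabi flow, because `Jᵀ = J`, and `M = 1` for the prescribed curvature flow. Both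
fields are bounded, so solutions are global. If a critical point exists, strong convexity on a
sublevel set gives exponential convergence to it (`exists_norm_sub_le_exp_of_descent`). Conversely,
a limit of a flow is an equilibrium, hence solves `L = L̂`. -/

/-! ### The contribution of an edge to the total curvature -/

/-- The total curvature that an edge with intersection angle `φ` contributes to a circle with
logarithmic radius `k`, when the circle at its other end has logarithmic radius `l`. -/
noncomputable def sector (φ k l : ℝ) : ℝ :=
  2 * (Real.exp k / √(1 + Real.exp k ^ 2) *
    Real.arctan (Real.sin φ * √(1 + Real.exp k ^ 2) / (Real.exp l + Real.exp k * Real.cos φ)))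

/-- In the tangent plane at `v`, the direction to the other centre has component `X` along the side
to `f` and `Y` across it, so half the angle is `arctan (Y / X)`. The assumption `φ ≤ π / 2` makes
`X` positive. -/
theorem kiteAngle_eq_arctan {φ a b : ℝ} (hφ : φ ∈ Ioc 0 (Real.pi / 2))
    (ha : a ∈ Ioo 0 (Real.pi / 2)) (hb : b ∈ Ioo 0 (Real.pi / 2)) :
    kiteAngle φ a b = 2 * Real.arctan (Real.sin b * Real.sin φ /
      (Real.sin a * Real.cos b + Real.cos a * Real.sin b * Real.cos φ)) := by
  have hsa : 0 < Real.sin a := Real.sin_pos_of_pos_of_lt_pi ha.1 (by linarith [ha.2, Real.pi_pos])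
  have hsb : 0 < Real.sin b := Real.sin_pos_of_pos_of_lt_pi hb.1 (by linarith [hb.2, Real.pi_pos])
  have hca : 0 < Real.cos a := Real.cos_pos_of_mem_Ioo ⟨by linarith [ha.1, Real.pi_pos], ha.2⟩
  have hcb : 0 < Real.cos b := Real.cos_pos_of_mem_Ioo ⟨by linarith [hb.1, Real.pi_pos], hb.2⟩
  have hsφ : 0 < Real.sin φ :=
    Real.sin_pos_of_pos_of_lt_pi hφ.1 (by linarith [hφ.2, Real.pi_pos])
  have hcφ : 0 ≤ Real.cos φ := Real.cos_nonneg_of_mem_Icc ⟨by linarith [hφ.1, Real.pi_pos], hφ.2⟩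
  set X := Real.sin a * Real.cos b + Real.cos a * Real.sin b * Real.cos φ with hX
  set Y := Real.sin b * Real.sin φ with hY
  have hXpos : 0 < X := by positivity
  have hYpos : 0 < Y := by positivity
  have ea := Real.sin_sq_add_cos_sq a
  have eb := Real.sin_sq_add_cos_sq b
  have eφ := Real.sin_sq_add_cos_sq φ
  have hpq : inner ℝ (spherePoint a 0) (spherePoint 0 0) = Real.cos a := by
    rw [inner_spherePoint]; simp
  have hps : inner ℝ (spherePoint a 0) (spherePoint b (Real.pi - φ)) =
      Real.cos a * Real.cos b - Real.sin a * Real.sin b * Real.cos φ := by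
    rw [inner_spherePoint]; simp; ring
  have hqs : inner ℝ (spherePoint 0 0) (spherePoint b (Real.pi - φ)) = Real.cos b := by
    rw [inner_spherePoint]; simp
  have hpp : inner ℝ (spherePoint a 0) (spherePoint a 0) = (1 : ℝ) := by
    rw [real_inner_self_eq_norm_sq, norm_spherePoint]; norm_num
  have hqq : inner ℝ (spherePoint 0 0) (spherePoint 0 0) = (1 : ℝ) := by
    rw [real_inner_self_eq_norm_sq, norm_spherePoint]; norm_num
  have hss : inner ℝ (spherePoint b (Real.pi - φ)) (spherePoint b (Real.pi - φ)) = (1 : ℝ) := by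
    rw [real_inner_self_eq_norm_sq, norm_spherePoint]; norm_num
  have key : ∀ p q s : EuclideanSpace ℝ (Fin 3), inner ℝ p p = (1 : ℝ) →
      inner ℝ (tangentDir p q) (tangentDir p s) =
        (inner ℝ q s - inner ℝ p q * inner ℝ p s : ℝ) := by
    intro p q s h
    simp only [tangentDir, inner_sub_left, inner_sub_right, inner_smul_left, inner_smul_right, h]
    simp [real_inner_comm]
  have hn1 : ‖tangentDir (spherePoint a 0) (spherePoint 0 0)‖ = Real.sin a := by
    rw [norm_eq_sqrt_real_inner, key _ _ _ hpp, hqq, hpq,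
      show 1 - Real.cos a * Real.cos a = Real.sin a ^ 2 by linarith]
    exact Real.sqrt_sq hsa.le
  have hn2 : ‖tangentDir (spherePoint a 0) (spherePoint b (Real.pi - φ))‖ =
      √(X ^ 2 + Y ^ 2) := by
    rw [norm_eq_sqrt_real_inner, key _ _ _ hpp, hss, hps]
    congr 1
    rw [hX, hY]
    linear_combination (-Real.sin b ^ 2 * Real.cos φ ^ 2 - Real.cos b ^ 2) * ea - eb -
      Real.sin b ^ 2 * eφ
  have hin : inner ℝ (tangentDir (spherePoint a 0) (spherePoint 0 0))
      (tangentDir (spherePoint a 0) (spherePoint b (Real.pi - φ))) = Real.sin a * X := by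
    rw [key _ _ _ hpp, hqs, hpq, hps, hX]
    linear_combination (-Real.cos b) * ea
  have hR : 0 < √(X ^ 2 + Y ^ 2) := by positivity
  have hR2 : √(X ^ 2 + Y ^ 2) ^ 2 = X ^ 2 + Y ^ 2 := Real.sq_sqrt (by positivity)
  rw [kiteAngle, sphereAngle, InnerProductGeometry.angle, hn1, hn2, hin,
    show Real.sin a * X / (Real.sin a * √(X ^ 2 + Y ^ 2)) = X / √(X ^ 2 + Y ^ 2) by field_simp,
    Real.arccos_eq_arctan (by positivity)]
  congr 2
  rw [show 1 - (X / √(X ^ 2 + Y ^ 2)) ^ 2 = (Y / √(X ^ 2 + Y ^ 2)) ^ 2 by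
    field_simp; rw [hR2]; ring, Real.sqrt_sq (by positivity)]
  field_simp

theorem two_cos_mul_kiteAngle {φ : ℝ} (hφ : φ ∈ Ioc 0 (Real.pi / 2)) (k l : ℝ) :
    Real.cos (Real.arctan (Real.exp (-k))) *
      kiteAngle φ (Real.arctan (Real.exp (-k))) (Real.arctan (Real.exp (-l))) = sector φ k l := by
  rw [kiteAngle_eq_arctan hφ ⟨Real.arctan_pos.2 (Real.exp_pos _), Real.arctan_lt_pi_div_two _⟩
    ⟨Real.arctan_pos.2 (Real.exp_pos _), Real.arctan_lt_pi_div_two _⟩, sector]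
  have hcφ : 0 ≤ Real.cos φ := Real.cos_nonneg_of_mem_Icc ⟨by linarith [hφ.1, Real.pi_pos], hφ.2⟩
  have h : ∀ k : ℝ, √(1 + Real.exp (-k) ^ 2) = √(1 + Real.exp k ^ 2) / Real.exp k := by
    intro k
    rw [eq_div_iff (Real.exp_pos k).ne', ← Real.sqrt_sq (Real.exp_pos k).le,
      ← Real.sqrt_mul (by positivity), Real.sqrt_sq (Real.exp_pos k).le]
    congr 1
    rw [Real.exp_neg]; field_simp; ring
  have hk : 0 < √(1 + Real.exp k ^ 2) := by positivity
  have hl : 0 < √(1 + Real.exp l ^ 2) := by positivity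
  simp only [Real.cos_arctan, Real.sin_arctan, h]
  simp only [Real.exp_neg]
  have e1 := Real.exp_pos k
  have e2 := Real.exp_pos l
  rw [show ∀ a b : ℝ, a * (2 * b) = 2 * (a * b) by intros; ring]
  congr 2
  · field_simp
  · congr 1
    field_simp

/-! ### Partial derivatives of the edge contribution -/

section Partials

variable {φ : ℝ}

/-- Minus half the partial derivative of `sector` in its second logarithmic radius. -/
noncomputable def sectorOff (φ k l : ℝ) : ℝ :=
  Real.exp k * Real.exp l * Real.sin φ / (Real.sin φ ^ 2 * (1 + Real.exp k ^ 2) +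
    (Real.exp l + Real.exp k * Real.cos φ) ^ 2)

/-- Half the derivative, in the first logarithmic radius, of the total curvature that an edge
contributes to both of its ends. -/
noncomputable def sectorExcess (φ k l : ℝ) : ℝ :=
  Real.exp k / (1 + Real.exp k ^ 2) *
    (Real.arctan (Real.sin φ * √(1 + Real.exp k ^ 2) / (Real.exp l + Real.exp k * Real.cos φ)) /
      √(1 + Real.exp k ^ 2) - Real.sin φ * (Real.exp l + Real.exp k * Real.cos φ) /
        (Real.sin φ ^ 2 * (1 + Real.exp k ^ 2) + (Real.exp l + Real.exp k * Real.cos φ) ^ 2))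

theorem sin_pos_of_mem (hφ : φ ∈ Ioc 0 (Real.pi / 2)) : 0 < Real.sin φ :=
  Real.sin_pos_of_pos_of_lt_pi hφ.1 (by linarith [hφ.2, Real.pi_pos])

theorem cos_nonneg_of_mem (hφ : φ ∈ Ioc 0 (Real.pi / 2)) : 0 ≤ Real.cos φ :=
  Real.cos_nonneg_of_mem_Icc ⟨by linarith [hφ.1, Real.pi_pos], hφ.2⟩

/-- With `x = exp k` and `y = exp l`, the denominator is `sin² φ + x² + y² + 2xy cos φ`. This is the
source of the symmetry of the Jacobian. -/
theorem sectorOff_comm (φ k l : ℝ) : sectorOff φ k l = sectorOff φ l k := by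
  have h : Real.sin φ ^ 2 * (1 + Real.exp k ^ 2) + (Real.exp l + Real.exp k * Real.cos φ) ^ 2 =
      Real.sin φ ^ 2 * (1 + Real.exp l ^ 2) + (Real.exp k + Real.exp l * Real.cos φ) ^ 2 := by
    linear_combination (Real.exp k ^ 2 - Real.exp l ^ 2) * Real.sin_sq_add_cos_sq φ
  rw [sectorOff, sectorOff, h]
  ring

theorem sectorOff_pos (hφ : φ ∈ Ioc 0 (Real.pi / 2)) (k l : ℝ) : 0 < sectorOff φ k l := by
  have := sin_pos_of_mem hφ
  unfold sectorOff
  positivity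

theorem sectorOff_le_one (hφ : φ ∈ Ioc 0 (Real.pi / 2)) (k l : ℝ) : sectorOff φ k l ≤ 1 := by
  have hs := sin_pos_of_mem hφ
  have hc := cos_nonneg_of_mem hφ
  have e1 := Real.exp_pos k
  have e2 := Real.exp_pos l
  have h1 := Real.sin_sq_add_cos_sq φ
  have hxy : 0 < Real.exp k * Real.exp l := by positivity
  rw [sectorOff, div_le_one (by positivity)]
  have h2 : Real.exp k * Real.exp l * Real.sin φ ≤ Real.exp k * Real.exp l * 1 :=
    mul_le_mul_of_nonneg_left (Real.sin_le_one φ) hxy.le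
  have h3 : 0 ≤ Real.exp k * Real.exp l * Real.cos φ := by positivity
  have h4 : Real.sin φ ^ 2 * (1 + Real.exp k ^ 2) + (Real.exp l + Real.exp k * Real.cos φ) ^ 2 =
      Real.sin φ ^ 2 + Real.exp k ^ 2 + Real.exp l ^ 2 +
        2 * (Real.exp k * Real.exp l * Real.cos φ) := by
    linear_combination (Real.exp k ^ 2) * h1
  nlinarith [sq_nonneg (Real.exp k - Real.exp l), sq_nonneg (Real.sin φ)]

/-- This is `sin 2θ < 2θ` at `θ = arctan u`. -/
theorem div_one_add_sq_lt_arctan {u : ℝ} (hu : 0 < u) : u / (1 + u ^ 2) < Real.arctan u := by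
  have h := Real.sin_lt (x := 2 * Real.arctan u) (by linarith [Real.arctan_pos.2 hu])
  rw [Real.sin_two_mul, Real.sin_arctan, Real.cos_arctan] at h
  have : 2 * (u / √(1 + u ^ 2)) * (1 / √(1 + u ^ 2)) = 2 * (u / (1 + u ^ 2)) := by
    rw [mul_assoc, div_mul_div_comm, Real.mul_self_sqrt (by positivity), mul_one]
  linarith

/-- Up to a positive factor the bracket is `arctan u - u / (1 + u ^ 2)`, where `u` is the argument
of the arctangent. -/
theorem sectorExcess_pos (hφ : φ ∈ Ioc 0 (Real.pi / 2)) (k l : ℝ) : 0 < sectorExcess φ k l := by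
  have hs := sin_pos_of_mem hφ
  have hc := cos_nonneg_of_mem hφ
  have e1 := Real.exp_pos k
  have e2 := Real.exp_pos l
  have hR : 0 < √(1 + Real.exp k ^ 2) := by positivity
  have hR2 : √(1 + Real.exp k ^ 2) ^ 2 = 1 + Real.exp k ^ 2 := Real.sq_sqrt (by positivity)
  unfold sectorExcess
  refine mul_pos (by positivity) ?_
  rw [← hR2, Real.sqrt_sq hR.le]
  set R := √(1 + Real.exp k ^ 2)
  have hN : 0 < Real.exp l + Real.exp k * Real.cos φ := by positivity
  set N := Real.exp l + Real.exp k * Real.cos φ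
  have h := div_one_add_sq_lt_arctan (u := Real.sin φ * R / N) (by positivity)
  have h2 : Real.sin φ * R / N / (1 + (Real.sin φ * R / N) ^ 2) =
      R * (Real.sin φ * N / (Real.sin φ ^ 2 * R ^ 2 + N ^ 2)) := by
    field_simp; ring
  rw [h2] at h
  rwa [sub_pos, lt_div_iff₀ hR, mul_comm]

theorem sectorExcess_le_two (hφ : φ ∈ Ioc 0 (Real.pi / 2)) (k l : ℝ) :
    sectorExcess φ k l ≤ 2 := by
  have hs := sin_pos_of_mem hφ
  have hc := cos_nonneg_of_mem hφ
  have e1 := Real.exp_pos k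
  have e2 := Real.exp_pos l
  have hR : 1 ≤ √(1 + Real.exp k ^ 2) := Real.one_le_sqrt.2 (by nlinarith)
  unfold sectorExcess
  have h0 : 0 ≤ Real.sin φ * (Real.exp l + Real.exp k * Real.cos φ) /
        (Real.sin φ ^ 2 * (1 + Real.exp k ^ 2) + (Real.exp l + Real.exp k * Real.cos φ) ^ 2) := by
    positivity
  have hA0 : 0 ≤ Real.arctan
      (Real.sin φ * √(1 + Real.exp k ^ 2) / (Real.exp l + Real.exp k * Real.cos φ)) :=
    (Real.arctan_pos.2 (by positivity)).le
  have hA := Real.arctan_lt_pi_div_two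
    (Real.sin φ * √(1 + Real.exp k ^ 2) / (Real.exp l + Real.exp k * Real.cos φ))
  have hA1 := div_le_self hA0 hR
  have hx : Real.exp k / (1 + Real.exp k ^ 2) ≤ 1 := by
    rw [div_le_one (by positivity)]; nlinarith
  have hx0 : 0 ≤ Real.exp k / (1 + Real.exp k ^ 2) := by positivity
  calc _ ≤ Real.exp k / (1 + Real.exp k ^ 2) * 2 :=
        mul_le_mul_of_nonneg_left (by linarith [Real.pi_lt_four]) hx0
    _ ≤ 1 * 2 := mul_le_mul_of_nonneg_right hx (by norm_num)
    _ = 2 := by norm_num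

theorem hasDerivAt_sector_left (hφ : φ ∈ Ioc 0 (Real.pi / 2)) (k l : ℝ) :
    HasDerivAt (fun k => sector φ k l) (2 * (sectorOff φ k l + sectorExcess φ k l)) k := by
  have hs := sin_pos_of_mem hφ
  have hc := cos_nonneg_of_mem hφ
  have e1 := Real.exp_pos k
  have e2 := Real.exp_pos l
  have hR : 0 < √(1 + Real.exp k ^ 2) := by positivity
  have hR2 : √(1 + Real.exp k ^ 2) ^ 2 = 1 + Real.exp k ^ 2 := Real.sq_sqrt (by positivity)
  have hN : 0 < Real.exp l + Real.exp k * Real.cos φ := by positivity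
  have d0 := Real.hasDerivAt_exp k
  have dR : HasDerivAt (fun k => √(1 + Real.exp k ^ 2))
      (Real.exp k ^ 2 / √(1 + Real.exp k ^ 2)) k := by
    have := ((d0.pow 2).const_add 1).sqrt (by simp only [Pi.pow_apply]; positivity)
    refine this.congr_deriv ?_
    simp; field_simp
  have d1 := d0.div dR hR.ne'
  have d2 := ((dR.const_mul (Real.sin φ)).div ((d0.mul_const (Real.cos φ)).const_add (Real.exp l))
    hN.ne').arctan
  refine ((d1.mul d2).const_mul 2).congr_deriv ?_
  simp only [sectorOff, sectorExcess, Pi.div_apply]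
  rw [← hR2]
  have hx2 : Real.exp k ^ 2 = √(1 + Real.exp k ^ 2) ^ 2 - 1 := by linarith
  rw [Real.sqrt_sq hR.le]
  generalize √(1 + Real.exp k ^ 2) = R at *
  generalize Real.arctan _ = A
  generalize Real.exp k = x at *
  generalize Real.exp l = y at *
  generalize Real.sin φ = s at *
  generalize Real.cos φ = c at *
  generalize hN' : y + x * c = N at *
  have h1 : 1 / (1 + (s * R / N) ^ 2) * ((s * (x ^ 2 / R) * N - s * R * (x * c)) / N ^ 2) =
      s * (x ^ 2 * N - R ^ 2 * x * c) / R / (s ^ 2 * R ^ 2 + N ^ 2) := by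
    field_simp; ring
  rw [h1]
  -- The term `R ^ 2 * y` produces `sectorOff`; the term `-N` joins the derivative of the prefactor
  -- `x / R` to form `sectorExcess`.
  have h2 : x ^ 2 * N - R ^ 2 * x * c = R ^ 2 * y - N := by
    rw [← hN']; linear_combination (y + x * c) * hx2
  rw [h2]
  have h3 : x * R - x * (x ^ 2 / R) = x / R := by
    field_simp; linear_combination -hx2
  rw [h3]
  field_simp
  ring

theorem hasDerivAt_sector_right (hφ : φ ∈ Ioc 0 (Real.pi / 2)) (k l : ℝ) :
    HasDerivAt (fun l => sector φ k l) (2 * -sectorOff φ k l) l := by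
  have hs := sin_pos_of_mem hφ
  have hc := cos_nonneg_of_mem hφ
  have e1 := Real.exp_pos k
  have e2 := Real.exp_pos l
  have hR : 0 < √(1 + Real.exp k ^ 2) := by positivity
  have hR2 : √(1 + Real.exp k ^ 2) ^ 2 = 1 + Real.exp k ^ 2 := Real.sq_sqrt (by positivity)
  have hN : 0 < Real.exp l + Real.exp k * Real.cos φ := by positivity
  have d2 := (((hasDerivAt_const l (Real.sin φ * √(1 + Real.exp k ^ 2))).div
    ((Real.hasDerivAt_exp l).add_const (Real.exp k * Real.cos φ)) hN.ne').arctan.const_mul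
      (Real.exp k / √(1 + Real.exp k ^ 2))).const_mul 2
  refine d2.congr_deriv ?_
  simp only [sectorOff, Pi.div_apply]
  rw [← hR2, Real.sqrt_sq hR.le]
  generalize √(1 + Real.exp k ^ 2) = R at *
  generalize Real.exp l + Real.exp k * Real.cos φ = N at *
  field_simp
  ring

theorem contDiff_sector (hφ : φ ∈ Ioc 0 (Real.pi / 2)) {n : ℕ∞} :
    ContDiff ℝ n (fun p : ℝ × ℝ => sector φ p.1 p.2) := by
  have hs := sin_pos_of_mem hφ
  have hc := cos_nonneg_of_mem hφ
  have hR : ContDiff ℝ n (fun p : ℝ × ℝ => √(1 + Real.exp p.1 ^ 2)) :=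
    ContDiff.sqrt (by fun_prop) fun p => by positivity
  unfold sector
  refine contDiff_const.mul (ContDiff.mul (ContDiff.div (by fun_prop) hR fun p => by positivity) ?_)
  refine ContDiff.arctan (ContDiff.div (contDiff_const.mul hR) (by fun_prop) fun p => ?_)
  have := Real.exp_pos p.1
  have := Real.exp_pos p.2
  positivity

theorem hasFDerivAt_sector (hφ : φ ∈ Ioc 0 (Real.pi / 2)) (p : ℝ × ℝ) :
    HasFDerivAt (fun p : ℝ × ℝ => sector φ p.1 p.2)
      ((2 * (sectorOff φ p.1 p.2 + sectorExcess φ p.1 p.2)) • ContinuousLinearMap.fst ℝ ℝ ℝ +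
        (2 * -sectorOff φ p.1 p.2) • ContinuousLinearMap.snd ℝ ℝ ℝ) p := by
  have h := ((contDiff_sector hφ (n := 1)).differentiable (by simp) p).hasFDerivAt
  have h1 := h.comp_hasDerivAt p.1 ((hasDerivAt_id p.1).prodMk (hasDerivAt_const p.1 p.2))
  have h2 := h.comp_hasDerivAt p.2 ((hasDerivAt_const p.2 p.1).prodMk (hasDerivAt_id p.2))
  refine h.congr_fderiv ?_
  ext
  · simpa using h1.unique (hasDerivAt_sector_left hφ p.1 p.2)
  · simpa using h2.unique (hasDerivAt_sector_right hφ p.1 p.2)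

end Partials

/-! ### Bounds and limits of the edge contribution -/

section Bounds

variable {φ : ℝ}

/-- The cosine of the radius, as a function of the logarithmic radius. -/
noncomputable def cosRadius (k : ℝ) : ℝ := Real.exp k / √(1 + Real.exp k ^ 2)

theorem cosRadius_pos (k : ℝ) : 0 < cosRadius k := by
  unfold cosRadius; positivity

theorem cosRadius_le_one (k : ℝ) : cosRadius k ≤ 1 := by
  rw [cosRadius, div_le_one (by positivity)]
  exact Real.le_sqrt_of_sq_le (by linarith)

theorem cosRadius_le_exp (k : ℝ) : cosRadius k ≤ Real.exp k := by
  rw [cosRadius]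
  exact div_le_self (Real.exp_pos k).le (Real.one_le_sqrt.2 (by nlinarith [Real.exp_pos k]))

theorem sqrt_one_add_exp_sq_add (k t : ℝ) :
    √(1 + Real.exp (k + t) ^ 2) = Real.exp t * √(Real.exp (-t) ^ 2 + Real.exp k ^ 2) := by
  rw [← Real.sqrt_sq (Real.exp_pos t).le, ← Real.sqrt_mul (by positivity),
    mul_add, ← mul_pow, ← mul_pow, ← Real.exp_add,
    ← Real.exp_add, add_neg_cancel, Real.exp_zero, one_pow, add_comm t k]

theorem tendsto_exp_neg_sq_atTop : Tendsto (fun t : ℝ => Real.exp (-t) ^ 2) atTop (𝓝 0) := by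
  simpa using (Real.tendsto_exp_neg_atTop_nhds_zero).pow 2

theorem tendsto_cosRadius_atTop : Tendsto cosRadius atTop (𝓝 1) := by
  have h : ∀ t, cosRadius t = 1 / √(Real.exp (-t) ^ 2 + 1) := by
    intro t
    have := sqrt_one_add_exp_sq_add 0 t
    rw [zero_add, Real.exp_zero, one_pow] at this
    have e := Real.exp_pos t
    rw [cosRadius, this]
    field_simp
  have h1 : Tendsto (fun t : ℝ => 1 / √(Real.exp (-t) ^ 2 + 1)) atTop (𝓝 (1 / √(0 + 1))) :=
    (tendsto_const_nhds).div ((tendsto_exp_neg_sq_atTop.add_const 1).sqrt) (by simp)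
  rw [funext h]
  simpa using h1

/-- The angles of the Euclidean triangle with sides `exp k` and `exp l` enclosing `π - φ`. -/
theorem arctan_add_arctan_euclidean (hφ : φ ∈ Ioc 0 (Real.pi / 2)) {x y : ℝ} (hx : 0 < x)
    (hy : 0 < y) :
    Real.arctan (Real.sin φ * x / (y + x * Real.cos φ)) +
      Real.arctan (Real.sin φ * y / (x + y * Real.cos φ)) = φ := by
  have hs := sin_pos_of_mem hφ
  have hc := cos_nonneg_of_mem hφ
  have h1 := Real.sin_sq_add_cos_sq φ
  set β := Real.arctan (Real.sin φ * y / (x + y * Real.cos φ)) with hβ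
  have hβ0 : 0 < β := Real.arctan_pos.2 (by positivity)
  have hβ1 : β < Real.pi / 2 := Real.arctan_lt_pi_div_two _
  have htan : Real.tan β = Real.sin φ * y / (x + y * Real.cos φ) := Real.tan_arctan _
  have hcβ : 0 < Real.cos β := Real.cos_pos_of_mem_Ioo ⟨by linarith, hβ1⟩
  have hsβ : Real.sin β = Real.sin φ * y / (x + y * Real.cos φ) * Real.cos β := by
    rw [← htan, Real.tan_mul_cos hcβ.ne']
  -- The subtraction formulas identify the first angle as `φ - β`, which lies in the range where
  -- `arctan` inverts `tan`.
  have h : Real.sin φ * x / (y + x * Real.cos φ) = Real.tan (φ - β) := by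
    rw [Real.tan_eq_sin_div_cos, Real.sin_sub, Real.cos_sub, hsβ]
    have h2 : Real.sin φ * Real.cos β -
        Real.cos φ * (Real.sin φ * y / (x + y * Real.cos φ) * Real.cos β) =
        Real.cos β / (x + y * Real.cos φ) * (Real.sin φ * x) := by
      field_simp; ring
    have h3 : Real.cos φ * Real.cos β +
        Real.sin φ * (Real.sin φ * y / (x + y * Real.cos φ) * Real.cos β) =
        Real.cos β / (x + y * Real.cos φ) * (y + x * Real.cos φ) := by
      field_simp; linear_combination y * h1
    rw [h2, h3, mul_div_mul_left _ _ (by positivity)]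
  rw [h, Real.arctan_tan (by linarith [hφ.1]) (by linarith [hφ.2]), sub_add_cancel]

theorem sector_pos (hφ : φ ∈ Ioc 0 (Real.pi / 2)) (k l : ℝ) : 0 < sector φ k l := by
  have hs := sin_pos_of_mem hφ
  have hc := cos_nonneg_of_mem hφ
  have : 0 < Real.arctan
      (Real.sin φ * √(1 + Real.exp k ^ 2) / (Real.exp l + Real.exp k * Real.cos φ)) :=
    Real.arctan_pos.2 (by positivity)
  unfold sector
  positivity

theorem sector_le_pi_mul_cosRadius (φ k l : ℝ) : sector φ k l ≤ Real.pi * cosRadius k := by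
  have h := Real.arctan_lt_pi_div_two
    (Real.sin φ * √(1 + Real.exp k ^ 2) / (Real.exp l + Real.exp k * Real.cos φ))
  have := mul_le_mul_of_nonneg_left h.le (cosRadius_pos k).le
  unfold sector
  unfold cosRadius at *
  linarith

/-- Replacing `√(1 + exp k ^ 2)` by `exp k` inside the arctangent gives the angle of the Euclidean
comparison triangle, which is smaller. -/
theorem le_sector (hφ : φ ∈ Ioc 0 (Real.pi / 2)) (k l : ℝ) :
    2 * (cosRadius k *
      Real.arctan (Real.sin φ * Real.exp k / (Real.exp l + Real.exp k * Real.cos φ))) ≤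
      sector φ k l := by
  have hs := sin_pos_of_mem hφ
  have hc := cos_nonneg_of_mem hφ
  have hx : Real.exp k ≤ √(1 + Real.exp k ^ 2) := Real.le_sqrt_of_sq_le (by linarith)
  unfold sector
  refine mul_le_mul_of_nonneg_left (mul_le_mul_of_nonneg_left ?_ (cosRadius_pos k).le) (by norm_num)
  refine Real.arctan_strictMono.monotone ?_
  gcongr

/-- The Euclidean angle is `φ` minus the opposite one, and the latter is at most its tangent. Used
when `k → ∞` while `l` stays bounded above: the contribution to one end alone then approaches `2φ`.
-/
theorem mul_sub_exp_le_sector (hφ : φ ∈ Ioc 0 (Real.pi / 2)) (k l : ℝ) :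
    2 * (cosRadius k * (φ - Real.exp (l - k))) ≤ sector φ k l := by
  have hs := sin_pos_of_mem hφ
  have hc := cos_nonneg_of_mem hφ
  refine le_trans ?_ (le_sector hφ k l)
  refine mul_le_mul_of_nonneg_left (mul_le_mul_of_nonneg_left ?_ (cosRadius_pos k).le) (by norm_num)
  have h := arctan_add_arctan_euclidean hφ (Real.exp_pos k) (Real.exp_pos l)
  have h1 : Real.arctan (Real.sin φ * Real.exp l / (Real.exp k + Real.exp l * Real.cos φ)) ≤
      Real.sin φ * Real.exp l / (Real.exp k + Real.exp l * Real.cos φ) := by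
    have h0 : 0 ≤ Real.sin φ * Real.exp l / (Real.exp k + Real.exp l * Real.cos φ) := by positivity
    generalize Real.sin φ * Real.exp l / (Real.exp k + Real.exp l * Real.cos φ) = u at h0
    rcases h0.eq_or_lt with rfl | hu
    · simp
    · have := Real.lt_tan (Real.arctan_pos.2 hu) (Real.arctan_lt_pi_div_two u)
      rw [Real.tan_arctan] at this
      exact this.le
  have h2 : Real.sin φ * Real.exp l / (Real.exp k + Real.exp l * Real.cos φ) ≤
      Real.exp (l - k) := by
    rw [Real.exp_sub]
    have : Real.sin φ * Real.exp l ≤ Real.exp l :=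
      mul_le_of_le_one_left (Real.exp_pos l).le (Real.sin_le_one φ)
    have h3 : 0 ≤ Real.exp l * Real.cos φ := by positivity
    gcongr
    linarith
  linarith

/-- The two Euclidean angles sum to `φ`; the extra cosine factors, at most `1`, give both terms a
common weight. Used when `k` and `l` both tend to infinity. -/
theorem mul_cosRadius_le_sector_add_sector (hφ : φ ∈ Ioc 0 (Real.pi / 2)) (k l : ℝ) :
    2 * φ * (cosRadius k * cosRadius l) ≤ sector φ k l + sector φ l k := by
  have hs := sin_pos_of_mem hφ
  have hc := cos_nonneg_of_mem hφ
  have h1 := le_sector hφ k l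
  have h2 := le_sector hφ l k
  have h := arctan_add_arctan_euclidean hφ (Real.exp_pos k) (Real.exp_pos l)
  have ha : 0 ≤ Real.arctan
      (Real.sin φ * Real.exp k / (Real.exp l + Real.exp k * Real.cos φ)) :=
    (Real.arctan_pos.2 (by positivity)).le
  have hb : 0 ≤ Real.arctan
      (Real.sin φ * Real.exp l / (Real.exp k + Real.exp l * Real.cos φ)) :=
    (Real.arctan_pos.2 (by positivity)).le
  generalize Real.arctan (Real.sin φ * Real.exp k / (Real.exp l + Real.exp k * Real.cos φ)) = a at *
  generalize Real.arctan (Real.sin φ * Real.exp l / (Real.exp k + Real.exp l * Real.cos φ)) = b at *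
  have h3 : cosRadius k * a * cosRadius l ≤ cosRadius k * a :=
    mul_le_of_le_one_right (mul_nonneg (cosRadius_pos k).le ha) (cosRadius_le_one l)
  have h4 : cosRadius l * b * cosRadius k ≤ cosRadius l * b :=
    mul_le_of_le_one_right (mul_nonneg (cosRadius_pos l).le hb) (cosRadius_le_one k)
  have h5 : 2 * φ * (cosRadius k * cosRadius l) =
      2 * (cosRadius k * a * cosRadius l) + 2 * (cosRadius l * b * cosRadius k) := by
    rw [← h]; ring
  linarith

theorem tendsto_sector_add (hφ : φ ∈ Ioc 0 (Real.pi / 2)) (k l : ℝ) :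
    Tendsto (fun t => sector φ (k + t) (l + t)) atTop
      (𝓝 (2 * Real.arctan (Real.sin φ * Real.exp k / (Real.exp l + Real.exp k * Real.cos φ)))) := by
  have hc := cos_nonneg_of_mem hφ
  have e1 := Real.exp_pos k
  have e2 := Real.exp_pos l
  have h : ∀ t, sector φ (k + t) (l + t) =
      2 * (Real.exp k / √(Real.exp (-t) ^ 2 + Real.exp k ^ 2) * Real.arctan (Real.sin φ *
        √(Real.exp (-t) ^ 2 + Real.exp k ^ 2) / (Real.exp l + Real.exp k * Real.cos φ))) := by
    intro t
    have e3 := Real.exp_pos t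
    rw [sector, sqrt_one_add_exp_sq_add, Real.exp_add, Real.exp_add]
    congr 2
    · field_simp
    · congr 1
      field_simp
  have hR : Tendsto (fun t : ℝ => √(Real.exp (-t) ^ 2 + Real.exp k ^ 2)) atTop
      (𝓝 (Real.exp k)) := by
    have := (tendsto_exp_neg_sq_atTop.add_const (Real.exp k ^ 2)).sqrt
    rwa [zero_add, Real.sqrt_sq e1.le] at this
  have h1 := ((tendsto_const_nhds (x := Real.exp k)).div hR e1.ne').mul
    ((Real.continuous_arctan.tendsto _).comp
      ((hR.const_mul (Real.sin φ)).div_const (Real.exp l + Real.exp k * Real.cos φ)))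
  rw [div_self e1.ne', one_mul] at h1
  rw [funext h]
  exact h1.const_mul 2

/-- Along `(k + t, l + t)` the `sectorOff` terms cancel and only the positive excess remains, so the
sum increases strictly to its Euclidean limit `2φ`. -/
theorem sector_add_sector_lt (hφ : φ ∈ Ioc 0 (Real.pi / 2)) (k l : ℝ) :
    sector φ k l + sector φ l k < 2 * φ := by
  have hd : ∀ a b t : ℝ, HasDerivAt (fun t => sector φ (a + t) (b + t))
      (2 * sectorExcess φ (a + t) (b + t)) t := by
    intro a b t
    have := (hasFDerivAt_sector hφ (a + t, b + t)).comp_hasDerivAt t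
      (((hasDerivAt_id t).const_add a).prodMk ((hasDerivAt_id t).const_add b))
    refine HasDerivAt.congr_deriv this ?_
    simp
    ring
  have hmono : StrictMono fun t => sector φ (k + t) (l + t) + sector φ (l + t) (k + t) := by
    refine strictMono_of_hasDerivAt_pos (fun t => (hd k l t).add (hd l k t)) fun t => ?_
    have := sectorExcess_pos hφ (k + t) (l + t)
    have := sectorExcess_pos hφ (l + t) (k + t)
    positivity
  have hlim := (tendsto_sector_add hφ k l).add (tendsto_sector_add hφ l k)
  rw [← mul_add, arctan_add_arctan_euclidean hφ (Real.exp_pos k) (Real.exp_pos l)] at hlim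
  have h1 := hmono.monotone.ge_of_tendsto hlim 1
  have h0 := hmono (zero_lt_one (α := ℝ))
  simp only [add_zero] at h0
  exact h0.trans_le h1

end Bounds

/-! ### Strictly convex potentials and their descent flows -/

section Potential

variable {ι : Type*} [Fintype ι]

/-- `ι → ℝ` carries the sup norm, whereas the convexity estimates use the dot product. -/
theorem norm_sq_le_dotProduct_self (h : ι → ℝ) : ‖h‖ ^ 2 ≤ h ⬝ᵥ h := by
  have h0 : 0 ≤ h ⬝ᵥ h := Finset.sum_nonneg fun i _ => mul_self_nonneg _
  have h1 : ‖h‖ ≤ √(h ⬝ᵥ h) := by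
    rw [pi_norm_le_iff_of_nonneg (Real.sqrt_nonneg _)]
    intro i
    refine Real.le_sqrt_of_sq_le ?_
    rw [Real.norm_eq_abs, sq_abs, sq]
    exact Finset.single_le_sum (f := fun i => h i * h i) (fun i _ => mul_self_nonneg _)
      (Finset.mem_univ i)
  calc ‖h‖ ^ 2 ≤ √(h ⬝ᵥ h) ^ 2 := by gcongr
    _ = h ⬝ᵥ h := Real.sq_sqrt h0

theorem dotProduct_self_pos {h : ι → ℝ} (hh : h ≠ 0) : 0 < h ⬝ᵥ h :=
  (pow_pos (norm_pos_iff.2 hh) 2).trans_le (norm_sq_le_dotProduct_self h)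

theorem dotProduct_sq_le (a b : ι → ℝ) : (a ⬝ᵥ b) ^ 2 ≤ (a ⬝ᵥ a) * (b ⬝ᵥ b) := by
  have := Finset.sum_mul_sq_le_sq_mul_sq Finset.univ a b
  simpa [dotProduct, sq] using this

/-- The dot product as a continuous linear map into the dual space. -/
noncomputable def dotCLM (ι : Type*) [Fintype ι] : (ι → ℝ) →L[ℝ] (ι → ℝ) →L[ℝ] ℝ :=
  ∑ i, (ContinuousLinearMap.proj (R := ℝ) (φ := fun _ : ι => ℝ) i).smulRight
    (ContinuousLinearMap.proj (R := ℝ) (φ := fun _ : ι => ℝ) i)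

@[simp]
theorem dotCLM_apply (a b : ι → ℝ) : dotCLM ι a b = a ⬝ᵥ b := by
  simp [dotCLM, dotProduct]

/-- A continuous family of positive definite operators is uniformly so on compact sets. -/
theorem exists_forall_mul_le_dotProduct {M : (ι → ℝ) → (ι → ℝ) →L[ℝ] (ι → ℝ)}
    (hM : Continuous M) (hpos : ∀ x h, h ≠ 0 → 0 < M x h ⬝ᵥ h) {B : Set (ι → ℝ)}
    (hB : IsCompact B) : ∃ c > 0, ∀ x ∈ B, ∀ h, c * (h ⬝ᵥ h) ≤ M x h ⬝ᵥ h := by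
  have hS : IsCompact (B ×ˢ Metric.sphere (0 : ι → ℝ) 1) := hB.prod (isCompact_sphere 0 1)
  have hf : Continuous fun p : (ι → ℝ) × (ι → ℝ) => dotCLM ι (M p.1 p.2) p.2 := by fun_prop
  obtain ⟨m, hm, hle⟩ := hS.exists_forall_le' (a := 0) hf.continuousOn fun p hp => by
    rw [dotCLM_apply]
    refine hpos _ _ fun h => ?_
    have := hp.2
    simp [h] at this
  -- `m` bounds the form below on sup-norm unit vectors, and `card ι` compares the dot product with
  -- the squared sup norm; the `+ 1` covers empty `ι`.
  refine ⟨m / (Fintype.card ι + 1), by positivity, fun x hx h => ?_⟩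
  rcases eq_or_ne h 0 with rfl | hh
  · simp
  have hn : 0 < ‖h‖ := norm_pos_iff.2 hh
  have h1 := hle (x, ‖h‖⁻¹ • h) ⟨hx, by simp [norm_smul, hn.ne']⟩
  rw [dotCLM_apply] at h1
  simp only [map_smul, smul_dotProduct, dotProduct_smul, smul_eq_mul] at h1
  have h2 : h ⬝ᵥ h ≤ Fintype.card ι * ‖h‖ ^ 2 := by
    rw [← nsmul_eq_mul]
    refine Finset.sum_le_card_nsmul _ _ _ fun i _ => ?_
    rw [← sq, ← sq_abs]
    gcongr
    exact norm_le_pi_norm h i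
  have h3 : m * ‖h‖ ^ 2 ≤ M x h ⬝ᵥ h := by
    have := mul_le_mul_of_nonneg_right h1 (sq_nonneg ‖h‖)
    field_simp at this
    linarith
  rw [div_mul_eq_mul_div, div_le_iff₀ (by positivity)]
  nlinarith [sq_nonneg ‖h‖]

variable {g : (ι → ℝ) → ι → ℝ} {J : (ι → ℝ) → (ι → ℝ) →L[ℝ] (ι → ℝ)}

/-- The scalar mean value theorem for `t ↦ g (y + t • (x - y)) ⬝ᵥ (x - y)`. -/
theorem exists_sub_dotProduct_sub_eq (hg : ∀ x, HasFDerivAt g (J x) x) (x y : ι → ℝ) :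
    ∃ t ∈ Ioo (0 : ℝ) 1,
      (g x - g y) ⬝ᵥ (x - y) = J (y + t • (x - y)) (x - y) ⬝ᵥ (x - y) := by
  have hd : ∀ t : ℝ, HasDerivAt (fun t : ℝ => g (y + t • (x - y)) ⬝ᵥ (x - y))
      (J (y + t • (x - y)) (x - y) ⬝ᵥ (x - y)) t := by
    intro t
    have h1 := (hg (y + t • (x - y))).comp_hasDerivAt t
      (((hasDerivAt_id t).smul_const (x - y)).const_add y)
    have h2 := ((dotCLM ι).flip (x - y)).hasFDerivAt.comp_hasDerivAt t h1
    simpa [Function.comp_def] using h2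
  obtain ⟨t, ht, h⟩ := exists_hasDerivAt_eq_slope _ _ zero_lt_one
    (fun t _ => (hd t).continuousAt.continuousWithinAt) fun t _ => hd t
  exact ⟨t, ht, by rw [h, sub_dotProduct]; simp⟩

theorem sub_dotProduct_sub_pos (hg : ∀ x, HasFDerivAt g (J x) x)
    (hpos : ∀ x h, h ≠ 0 → 0 < J x h ⬝ᵥ h) {x y : ι → ℝ} (hxy : x ≠ y) :
    0 < (g x - g y) ⬝ᵥ (x - y) := by
  obtain ⟨t, -, h⟩ := exists_sub_dotProduct_sub_eq hg x y
  rw [h]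
  exact hpos _ _ (sub_ne_zero.2 hxy)

theorem injective_of_posDef_fderiv (hg : ∀ x, HasFDerivAt g (J x) x)
    (hpos : ∀ x h, h ≠ 0 → 0 < J x h ⬝ᵥ h) : Function.Injective g := by
  intro x y h
  by_contra hxy
  simpa [h] using sub_dotProduct_sub_pos hg hpos hxy

theorem mul_le_sub_dotProduct_sub (hg : ∀ x, HasFDerivAt g (J x) x) {B : Set (ι → ℝ)}
    (hB : Convex ℝ B) {c : ℝ} (hc : ∀ x ∈ B, ∀ h, c * (h ⬝ᵥ h) ≤ J x h ⬝ᵥ h) {x y : ι → ℝ}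
    (hx : x ∈ B) (hy : y ∈ B) : c * ((x - y) ⬝ᵥ (x - y)) ≤ (g x - g y) ⬝ᵥ (x - y) := by
  obtain ⟨t, ht, h⟩ := exists_sub_dotProduct_sub_eq hg x y
  rw [h]
  exact hc _ (hB.add_smul_sub_mem hy hx ⟨ht.1.le, ht.2.le⟩) _

/-- A vector field with symmetric derivative is a gradient. -/
theorem exists_potential (hg : ∀ x, HasFDerivAt g (J x) x)
    (hsymm : ∀ x a b, J x a ⬝ᵥ b = J x b ⬝ᵥ a) :
    ∃ F : (ι → ℝ) → ℝ, ∀ x, HasFDerivAt F (dotCLM ι (g x)) x := by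
  have hω : ∀ x, HasFDerivAt (fun x => dotCLM ι (g x)) ((dotCLM ι).comp (J x)) x := fun x =>
    (dotCLM ι).hasFDerivAt.comp x (hg x)
  obtain ⟨F, hF⟩ := convex_univ.exists_forall_hasFDerivAt_of_fderiv_symmetric isOpen_univ
    (fun x _ => (hω x).differentiableAt.differentiableWithinAt) fun x _ a b => by
      simpa [(hω x).fderiv] using hsymm x a b
  exact ⟨F, fun x => hF x (mem_univ x)⟩

variable {F : (ι → ℝ) → ℝ}

/-- The increment of `F` is the slope at an intermediate point of the segment, and monotonicity of
`g` bounds that slope below by the one at `x`. -/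
theorem le_sub_of_gradient_monotone (hF : ∀ x, HasFDerivAt F (dotCLM ι (g x)) x)
    (hg : ∀ x, HasFDerivAt g (J x) x) (hpos : ∀ x h, h ≠ 0 → 0 < J x h ⬝ᵥ h) (x y : ι → ℝ) :
    g x ⬝ᵥ (y - x) ≤ F y - F x := by
  have hd : ∀ t : ℝ, HasDerivAt (fun t : ℝ => F (x + t • (y - x)))
      (g (x + t • (y - x)) ⬝ᵥ (y - x)) t := by
    intro t
    have h1 := (hF (x + t • (y - x))).comp_hasDerivAt t
      (((hasDerivAt_id t).smul_const (y - x)).const_add x)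
    simpa [Function.comp_def] using h1
  obtain ⟨t, ht, h⟩ := exists_hasDerivAt_eq_slope _ _ zero_lt_one
    (fun t _ => (hd t).continuousAt.continuousWithinAt) fun t _ => hd t
  have h1 : g (x + t • (y - x)) ⬝ᵥ (y - x) = F y - F x := by rw [h]; simp
  rw [← h1]
  rcases eq_or_ne (x + t • (y - x)) x with hx | hx
  · rw [hx]
  have h2 := sub_dotProduct_sub_pos hg hpos hx
  rw [add_sub_cancel_left, dotProduct_smul, smul_eq_mul, sub_dotProduct] at h2
  linarith [pos_of_mul_pos_right h2 ht.1.le]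

/-- Sublevel sets of a strictly convex function with a critical point are bounded. -/
theorem exists_sublevel_subset_closedBall (hF : ∀ x, HasFDerivAt F (dotCLM ι (g x)) x)
    (hg : ∀ x, HasFDerivAt g (J x) x) (hJ : Continuous J)
    (hpos : ∀ x h, h ≠ 0 → 0 < J x h ⬝ᵥ h) {p : ι → ℝ} (hp : g p = 0) (a : ℝ) :
    ∃ R, ∀ x, F x ≤ a → x ∈ Metric.closedBall p R := by
  obtain ⟨c, hc, hle⟩ := exists_forall_mul_le_dotProduct hJ hpos (isCompact_closedBall p 1)
  refine ⟨1 + |a - F p| / c, fun x hx => ?_⟩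
  rw [Metric.mem_closedBall, dist_eq_norm]
  rcases le_or_gt ‖x - p‖ 1 with h1 | h1
  · exact h1.trans (le_add_of_nonneg_right (by positivity))
  set r := ‖x - p‖ with hr
  have hr0 : 0 < r := by linarith
  -- On the unit sphere around `p` the radial slope of `F` is at least `c`. By convexity `F` grows
  -- at least at rate `c` beyond it, so `(r - 1) * c ≤ F x - F p`.
  set h := r⁻¹ • (x - p) with hh
  have hn : ‖h‖ = 1 := by rw [hh, norm_smul, norm_inv, norm_norm, ← hr, inv_mul_cancel₀ hr0.ne']
  have hx' : x - (p + h) = (r - 1) • h := by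
    rw [hh, sub_smul, one_smul, smul_smul, mul_inv_cancel₀ hr0.ne', one_smul]
    abel
  have h2 := le_sub_of_gradient_monotone hF hg hpos (p + h) x
  have h3 := le_sub_of_gradient_monotone hF hg hpos p (p + h)
  have h4 := mul_le_sub_dotProduct_sub hg (convex_closedBall p 1) hle (x := p + h) (y := p)
    (by simp [hn]) (by simp)
  rw [hp, zero_dotProduct] at h3
  rw [hp, sub_zero, add_sub_cancel_left] at h4
  rw [hx', dotProduct_smul, smul_eq_mul] at h2
  have h5 := norm_sq_le_dotProduct_self h
  rw [hn, one_pow] at h5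
  have h6 : c ≤ g (p + h) ⬝ᵥ h := by nlinarith
  have h7 : (r - 1) * c ≤ (r - 1) * (g (p + h) ⬝ᵥ h) :=
    mul_le_mul_of_nonneg_left h6 (by linarith)
  have h8 : (r - 1) * c ≤ |a - F p| := by
    have := le_abs_self (a - F p)
    linarith
  rw [← le_div_iff₀ hc] at h8
  linarith

theorem antitoneOn_Ici_of_hasDerivWithinAt {f f' : ℝ → ℝ}
    (hf : ∀ t ∈ Ici (0 : ℝ), HasDerivWithinAt f (f' t) (Ici 0) t)
    (hf' : ∀ t ∈ Ici (0 : ℝ), f' t ≤ 0) : AntitoneOn f (Ici 0) := by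
  refine antitoneOn_of_hasDerivWithinAt_nonpos (convex_Ici 0)
    (fun t ht => (hf t ht).continuousWithinAt) (f' := f') (fun t ht => ?_) fun t ht => ?_
  · exact (hf t (interior_subset ht)).mono interior_subset
  · exact hf' t (interior_subset ht)

/-- The descent flow `dx/dt = -M(x) g(x)` of a strictly convex potential with gradient `g`, for a
positive definite family `M`, converges exponentially fast to the critical point. -/
theorem exists_norm_sub_le_exp_of_descent (hg : ∀ x, HasFDerivAt g (J x) x) (hJ : Continuous J)
    (hsymm : ∀ x a b, J x a ⬝ᵥ b = J x b ⬝ᵥ a) (hpos : ∀ x h, h ≠ 0 → 0 < J x h ⬝ᵥ h)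
    {M : (ι → ℝ) → (ι → ℝ) →L[ℝ] (ι → ℝ)} (hM : Continuous M)
    (hMpos : ∀ x h, h ≠ 0 → 0 < M x h ⬝ᵥ h) {p : ι → ℝ} (hp : g p = 0) {x : ℝ → ι → ℝ}
    (hx : ∀ t ∈ Ici (0 : ℝ), HasDerivWithinAt x (-M (x t) (g (x t))) (Ici 0) t) :
    ∃ C c : ℝ, 0 < c ∧ ∀ t ≥ 0, ‖x t - p‖ ≤ C * Real.exp (-c * t) := by
  obtain ⟨F, hF⟩ := exists_potential hg hsymm
  have hd : ∀ t ∈ Ici (0 : ℝ), HasDerivWithinAt (fun t => F (x t))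
      (-(M (x t) (g (x t)) ⬝ᵥ g (x t))) (Ici 0) t := by
    intro t ht
    have := (hF (x t)).comp_hasDerivWithinAt t (hx t ht)
    simpa [Function.comp_def, dotProduct_comm] using this
  have hMnn : ∀ y h, 0 ≤ M y h ⬝ᵥ h := by
    intro y h
    rcases eq_or_ne h 0 with rfl | hh
    · simp
    · exact (hMpos y h hh).le
  have hanti : AntitoneOn (fun t => F (x t)) (Ici 0) :=
    antitoneOn_Ici_of_hasDerivWithinAt hd fun t _ => neg_nonpos.2 (hMnn _ _)
  obtain ⟨R, hR⟩ := exists_sublevel_subset_closedBall hF hg hJ hpos hp (F (x 0))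
  have hB : ∀ t ≥ 0, x t ∈ Metric.closedBall p R := fun t ht =>
    hR _ (hanti self_mem_Ici ht ht)
  have hpB : p ∈ Metric.closedBall p R :=
    Metric.mem_closedBall_self (Metric.nonneg_of_mem_closedBall (hB 0 le_rfl))
  obtain ⟨a, ha, hJa⟩ := exists_forall_mul_le_dotProduct hJ hpos (isCompact_closedBall p R)
  obtain ⟨b, hb, hMb⟩ := exists_forall_mul_le_dotProduct hM hMpos (isCompact_closedBall p R)
  -- A Łojasiewicz inequality: `F y - F p ≤ g y ⬝ᵥ (y - p)` by convexity, and strong monotonicity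
  -- with Cauchy–Schwarz bounds `a` times the right side by `g y ⬝ᵥ g y`.
  have hupper : ∀ y ∈ Metric.closedBall p R, a * (F y - F p) ≤ g y ⬝ᵥ g y := by
    intro y hy
    have h1 := le_sub_of_gradient_monotone hF hg hpos y p
    have h2 := mul_le_sub_dotProduct_sub hg (convex_closedBall p R) hJa hy hpB
    rw [hp, sub_zero] at h2
    have h3 := dotProduct_sq_le (g y) (y - p)
    have h4 : g y ⬝ᵥ (p - y) = -(g y ⬝ᵥ (y - p)) := by rw [← dotProduct_neg, neg_sub]
    have h5 : 0 ≤ (y - p) ⬝ᵥ (y - p) := (sq_nonneg _).trans (norm_sq_le_dotProduct_self _)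
    have h6 : 0 ≤ g y ⬝ᵥ g y := (sq_nonneg _).trans (norm_sq_le_dotProduct_self _)
    generalize g y ⬝ᵥ (y - p) = u at *
    generalize g y ⬝ᵥ g y = v at *
    generalize (y - p) ⬝ᵥ (y - p) = w at *
    have h7 : a * u ≤ v := by
      rcases le_or_gt u 0 with hu | hu
      · nlinarith
      · refine le_of_mul_le_mul_right ?_ hu
        nlinarith
    nlinarith
  have hlower : ∀ y ∈ Metric.closedBall p R, a / 4 * ‖y - p‖ ^ 2 ≤ F y - F p := by
    intro y hy
    -- The slope at the midpoint is already controlled by strong monotonicity, and the gradient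
    -- inequality there gives quadratic growth with constant `a / 4`.
    set m := p + (1 / 2 : ℝ) • (y - p) with hm
    have hmB : m ∈ Metric.closedBall p R :=
      (convex_closedBall p R).add_smul_sub_mem hpB hy ⟨by norm_num, by norm_num⟩
    have h1 := le_sub_of_gradient_monotone hF hg hpos m y
    have h2 := le_sub_of_gradient_monotone hF hg hpos p m
    have h3 := mul_le_sub_dotProduct_sub hg (convex_closedBall p R) hJa hmB hpB
    have h4 : m - p = (1 / 2 : ℝ) • (y - p) := by rw [hm, add_sub_cancel_left]
    have h5 : y - m = (1 / 2 : ℝ) • (y - p) := by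
      rw [hm]; ext i; simp; ring
    rw [hp, zero_dotProduct] at h2
    rw [hp, sub_zero, h4] at h3
    rw [h5] at h1
    have h6 := norm_sq_le_dotProduct_self (y - p)
    simp only [smul_dotProduct, dotProduct_smul, smul_eq_mul] at h1 h3
    nlinarith
  have hdecay : AntitoneOn (fun t => Real.exp (a * b * t) * (F (x t) - F p)) (Ici 0) := by
    refine antitoneOn_Ici_of_hasDerivWithinAt (f' := fun t =>
      Real.exp (a * b * t) * (a * b) * (F (x t) - F p) +
        Real.exp (a * b * t) * -(M (x t) (g (x t)) ⬝ᵥ g (x t))) (fun t ht => ?_) fun t ht => ?_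
    · have h1 : HasDerivAt (fun t : ℝ => Real.exp (a * b * t)) (Real.exp (a * b * t) * (a * b)) t := by
        simpa using ((hasDerivAt_id t).const_mul (a * b)).exp
      exact h1.hasDerivWithinAt.mul ((hd t ht).sub_const (F p))
    · have h1 := hMb _ (hB t ht) (g (x t))
      have h2 := mul_le_mul_of_nonneg_left (hupper _ (hB t ht)) hb.le
      rw [mul_assoc, ← mul_add]
      refine mul_nonpos_of_nonneg_of_nonpos (Real.exp_pos _).le ?_
      linarith
  -- The potential decays at rate `a * b` and dominates `a / 4` times the squared distance; the
  -- square root halves the rate.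
  refine ⟨√(4 / a * (F (x 0) - F p)), a * b / 2, by positivity, fun t ht => ?_⟩
  have h1 := hdecay self_mem_Ici ht ht
  simp only [mul_zero, Real.exp_zero, one_mul] at h1
  have h2 := hlower _ (hB t ht)
  have h0 : 0 ≤ F (x 0) - F p := le_trans (by positivity) (hlower _ (hB 0 le_rfl))
  refine abs_le_of_sq_le_sq' ?_ (by positivity) |>.2
  rw [mul_pow, Real.sq_sqrt (by positivity), ← Real.exp_nat_mul]
  have h3 : Real.exp (a * b * t) * Real.exp (((2 : ℕ) : ℝ) * (-(a * b / 2) * t)) = 1 := by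
    rw [← Real.exp_add, ← Real.exp_zero]
    congr 1
    push_cast
    ring
  have h4 := Real.exp_pos (((2 : ℕ) : ℝ) * (-(a * b / 2) * t))
  generalize Real.exp (((2 : ℕ) : ℝ) * (-(a * b / 2) * t)) = E at *
  have h5 : F (x t) - F p ≤ (F (x 0) - F p) * E := by
    have := mul_le_mul_of_nonneg_right h1 h4.le
    rwa [mul_right_comm, h3, one_mul] at this
  have h6 : ‖x t - p‖ ^ 2 ≤ 4 / a * (F (x t) - F p) := by
    rw [div_mul_eq_mul_div, le_div_iff₀ ha]
    linarith
  refine h6.trans ?_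
  rw [mul_assoc]
  gcongr

end Potential

/-! ### Ordinary differential equations with bounded vector field -/

section ODE

variable {ι : Type*} [Fintype ι] {X : (ι → ℝ) → ι → ℝ}

theorem exists_lipschitzOnWith_closedBall (hX : ContDiff ℝ 1 X) (p : ι → ℝ) (R : ℝ) :
    ∃ C, LipschitzOnWith C X (Metric.closedBall p R) :=
  hX.contDiffOn.exists_lipschitzOnWith one_ne_zero (convex_closedBall p R)
    (isCompact_closedBall p R)

/-- Up to a fixed time both trajectories stay in one ball, where `X` is Lipschitz. -/
theorem eqOn_Ici_of_isSolutionOn (hX : ContDiff ℝ 1 X) {x y : ℝ → ι → ℝ}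
    (hx : ∀ t ∈ Ici (0 : ℝ), HasDerivWithinAt x (X (x t)) (Ici 0) t)
    (hy : ∀ t ∈ Ici (0 : ℝ), HasDerivWithinAt y (X (y t)) (Ici 0) t) (h0 : x 0 = y 0) :
    EqOn x y (Ici 0) := by
  intro T hT
  have hcx : ContinuousOn x (Icc 0 T) := fun t ht =>
    ((hx t ht.1).mono Icc_subset_Ici_self).continuousWithinAt
  have hcy : ContinuousOn y (Icc 0 T) := fun t ht =>
    ((hy t ht.1).mono Icc_subset_Ici_self).continuousWithinAt
  obtain ⟨R, hR⟩ := ((isCompact_Icc.image_of_continuousOn hcx).union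
    (isCompact_Icc.image_of_continuousOn hcy)).isBounded.subset_closedBall 0
  obtain ⟨C, hC⟩ := exists_lipschitzOnWith_closedBall hX 0 R
  refine ODE_solution_unique_of_mem_Icc_right (v := fun _ => X) (K := C)
    (s := fun _ => Metric.closedBall 0 R) (fun _ _ => hC) hcx (fun t ht => ?_) (fun t ht => ?_)
    hcy (fun t ht => ?_) (fun t ht => ?_) h0 ⟨hT, le_rfl⟩
  · exact (hx t ht.1).mono (Ici_subset_Ici.2 ht.1)
  · exact hR (.inl (mem_image_of_mem x ⟨ht.1, ht.2.le⟩))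
  · exact (hy t ht.1).mono (Ici_subset_Ici.2 ht.1)
  · exact hR (.inr (mem_image_of_mem y ⟨ht.1, ht.2.le⟩))

theorem HasDerivAt.comp_neg_time {x : ℝ → ι → ℝ} {v : ι → ℝ} {t : ℝ} (h : HasDerivAt x v (-t)) :
    HasDerivAt (fun s => x (-s)) (-v) t := by
  simpa [Function.comp_def] using h.scomp t (hasDerivAt_neg t)

theorem eq_of_isSolution (hX : ContDiff ℝ 1 X) {x y : ℝ → ι → ℝ}
    (hx : ∀ t, HasDerivAt x (X (x t)) t) (hy : ∀ t, HasDerivAt y (X (y t)) t) (h0 : x 0 = y 0) :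
    x = y := by
  funext t
  rcases le_total 0 t with ht | ht
  · exact eqOn_Ici_of_isSolutionOn hX (fun t _ => (hx t).hasDerivWithinAt)
      (fun t _ => (hy t).hasDerivWithinAt) h0 ht
  · have := eqOn_Ici_of_isSolutionOn (X := fun z => -X z) hX.neg
      (fun t _ => (hx (-t)).comp_neg_time.hasDerivWithinAt)
      (fun t _ => (hy (-t)).comp_neg_time.hasDerivWithinAt) (by simpa using h0)
      (neg_nonneg.2 ht : -t ∈ Ici (0 : ℝ))
    simpa using this

/-- A bounded continuously differentiable vector field is complete. -/
theorem exists_isSolution (hX : ContDiff ℝ 1 X) {B : ℝ} (hB : ∀ x, ‖X x‖ ≤ B) (x₀ : ι → ℝ) :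
    ∃ x : ℝ → ι → ℝ, (∀ t, HasDerivAt x (X (x t)) t) ∧ x 0 = x₀ := by
  lift B to NNReal using (norm_nonneg _).trans (hB 0)
  have hloc : ∀ n : ℕ, ∃ x : ℝ → ι → ℝ, x 0 = x₀ ∧
      ∀ t ∈ Icc (-(n : ℝ)) n, HasDerivWithinAt x (X (x t)) (Icc (-(n : ℝ)) n) t := by
    intro n
    -- At speed at most `B` a solution cannot leave this ball within time `n`, so Picard–Lindelöf
    -- covers all of `[-n, n]`.
    obtain ⟨C, hC⟩ := exists_lipschitzOnWith_closedBall hX x₀ (B * n : NNReal)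
    have hP : IsPicardLindelof (fun _ => X) (tmin := -(n : ℝ)) (tmax := n)
        ⟨0, by simp⟩ x₀ (B * n) 0 B C :=
      { lipschitzOnWith := fun _ _ => hC
        continuousOn := fun _ _ => continuousOn_const
        norm_le := fun _ _ x _ => hB x
        mul_max_le := by simp }
    exact hP.exists_eq_forall_mem_Icc_hasDerivWithinAt₀
  choose x hx0 hx using hloc
  have hx' : ∀ n : ℕ, ∀ t ∈ Ioo (-(n : ℝ)) n, HasDerivAt (x n) (X (x n t)) t := fun n t ht =>
    (hx n t ⟨ht.1.le, ht.2.le⟩).hasDerivAt (Icc_mem_nhds ht.1 ht.2)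
  have hagree : ∀ m n : ℕ, m ≤ n → EqOn (x m) (x n) (Ioo (-(m : ℝ)) m) := by
    intro m n hmn t ht
    have hm0 : (0 : ℝ) < m := by linarith [ht.1, ht.2]
    have hmn' : (m : ℝ) ≤ n := by exact_mod_cast hmn
    have hs : Icc (-(m : ℝ)) m ⊆ Icc (-(n : ℝ)) n := Icc_subset_Icc (by linarith) hmn'
    have hcm : ContinuousOn (x m) (Icc (-(m : ℝ)) m) := fun t ht => (hx m t ht).continuousWithinAt
    have hcn : ContinuousOn (x n) (Icc (-(m : ℝ)) m) := fun t ht =>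
      ((hx n t (hs ht)).mono hs).continuousWithinAt
    obtain ⟨R, hR⟩ := ((isCompact_Icc.image_of_continuousOn hcm).union
      (isCompact_Icc.image_of_continuousOn hcn)).isBounded.subset_closedBall 0
    obtain ⟨C, hC⟩ := exists_lipschitzOnWith_closedBall hX 0 R
    refine ODE_solution_unique_of_mem_Ioo (v := fun _ => X) (K := C) (t₀ := 0)
      (s := fun _ => Metric.closedBall 0 R) (fun _ _ => hC) ⟨by linarith, hm0⟩
      (fun t ht => ⟨hx' m t ht, ?_⟩) (fun t ht => ⟨hx' n t ⟨by linarith [ht.1], by linarith [ht.2]⟩,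
        ?_⟩) (by rw [hx0, hx0]) ht
    · exact hR (.inl (mem_image_of_mem _ ⟨ht.1.le, ht.2.le⟩))
    · exact hR (.inr (mem_image_of_mem _ ⟨ht.1.le, ht.2.le⟩))
  have hN : ∀ t : ℝ, t ∈ Ioo (-((⌊|t|⌋₊ + 1 : ℕ) : ℝ)) (⌊|t|⌋₊ + 1 : ℕ) := by
    intro t
    have := Nat.lt_floor_add_one |t|
    push_cast
    exact ⟨by linarith [neg_abs_le t], by linarith [le_abs_self t]⟩
  have hmem : ∀ {m n : ℕ} {t : ℝ}, t ∈ Ioo (-(m : ℝ)) m → t ∈ Ioo (-(n : ℝ)) n →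
      x m t = x n t := by
    intro m n t hm hn
    rcases le_total m n with h | h
    · exact hagree m n h hm
    · exact (hagree n m h hn).symm
  -- The index strictly exceeds `|t|`, so `t` is interior to the interval of the solution used.
  refine ⟨fun t => x (⌊|t|⌋₊ + 1) t, fun t => ?_, hx0 _⟩
  refine (hx' _ t (hN t)).congr_of_eventuallyEq ?_
  filter_upwards [Ioo_mem_nhds (hN t).1 (hN t).2] with s hs
  exact hmem (hN s) hs

/-- The limit of a solution of an autonomous equation is an equilibrium. -/
theorem eq_zero_of_tendsto_of_isSolutionOn {x : ℝ → ι → ℝ} {y : ι → ℝ}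
    (hX : ContinuousAt X y)
    (hx : ∀ t ∈ Ici (0 : ℝ), HasDerivWithinAt x (X (x t)) (Ici 0) t)
    (hy : Tendsto x atTop (𝓝 y)) : X y = 0 := by
  funext i
  -- The unit-time increments tend to `0`, while the field at the intermediate times tends to `X y`.
  have hslope : ∀ n : ℕ, ∃ c ∈ Ioo (n : ℝ) (n + 1), X (x c) i = x (n + 1) i - x n i := by
    intro n
    have hd : ∀ t ∈ Ioi (0 : ℝ), HasDerivAt (fun t => x t i) (X (x t) i) t := fun t ht =>
      hasDerivAt_pi.1 ((hx t (mem_Ioi.1 ht).le).hasDerivAt (Ici_mem_nhds ht)) i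
    have hc : ContinuousOn (fun t => x t i) (Ici 0) := fun t ht =>
      (hasDerivWithinAt_pi.1 (hx t ht) i).continuousWithinAt
    have hn : (0 : ℝ) ≤ n := n.cast_nonneg
    obtain ⟨c, hc, h⟩ := exists_hasDerivAt_eq_slope (fun t => x t i) (fun t => X (x t) i)
      (a := (n : ℝ)) (b := n + 1) (by linarith) (hc.mono fun t ht => hn.trans ht.1)
      fun t ht => hd t (hn.trans_lt ht.1)
    exact ⟨c, hc, by simpa using h⟩
  choose c hc h using hslope
  have hct : Tendsto c atTop atTop :=
    tendsto_atTop_mono (fun n => (hc n).1.le) tendsto_natCast_atTop_atTop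
  have h1 : Tendsto (fun n => X (x (c n)) i) atTop (𝓝 (X y i)) :=
    ((continuous_apply i).tendsto _).comp (hX.tendsto.comp (hy.comp hct))
  have hyi : Tendsto (fun t => x t i) atTop (𝓝 (y i)) := ((continuous_apply i).tendsto _).comp hy
  have h2 : Tendsto (fun n : ℕ => x ((n : ℝ) + 1) i - x n i) atTop (𝓝 (y i - y i)) :=
    (hyi.comp (tendsto_atTop_add_const_right _ 1 tendsto_natCast_atTop_atTop)).sub
      (hyi.comp tendsto_natCast_atTop_atTop)
  rw [sub_self] at h2
  exact tendsto_nhds_unique h1 (h2.congr fun n => (h n).symm)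

end ODE

/-! ### Total curvatures in logarithmic coordinates -/

section Curvature

variable {α β : Type*} {G : Graph α β} [Fintype V(G)] [Fintype E(G)] {Φ : E(G) → ℝ}

/-- The total curvatures as functions of the logarithmic radii. -/
noncomputable def curvatureMap (Φ : E(G) → ℝ) (K : V(G) → ℝ) : V(G) → ℝ :=
  totalCurvature Φ (radiusOf K)

open scoped Classical in
theorem curvatureMap_apply (hΦ : ∀ e, Φ e ∈ Ioc 0 (Real.pi / 2)) (K : V(G) → ℝ) (v : V(G)) :
    curvatureMap Φ K v =
      ∑ e : E(G), ∑ w : V(G), if G.IsLink e v w then sector (Φ e) (K v) (K w) else 0 := by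
  have hr := radiusOf_mem K v
  have hs : Real.sin (radiusOf K v) ≠ 0 :=
    (Real.sin_pos_of_pos_of_lt_pi hr.1 (by linarith [hr.2, Real.pi_pos])).ne'
  rw [curvatureMap, totalCurvature, circumference, Real.cot_eq_cos_div_sin,
    show ∀ a b c : ℝ, b ≠ 0 → a / b * (c * b) = a * c by intros; field_simp, coneAngle,
    Finset.mul_sum]
  swap
  · exact hs
  refine Finset.sum_congr rfl fun e _ => ?_
  rw [Finset.mul_sum]
  refine Finset.sum_congr rfl fun w _ => ?_
  split_ifs
  · exact two_cos_mul_kiteAngle (hΦ e) (K v) (K w)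
  · exact mul_zero _

theorem contDiff_curvatureMap (hΦ : ∀ e, Φ e ∈ Ioc 0 (Real.pi / 2)) {n : ℕ∞} :
    ContDiff ℝ n (curvatureMap Φ) := by
  classical
  rw [contDiff_pi]
  intro v
  simp only [curvatureMap_apply hΦ]
  refine ContDiff.sum fun e _ => ContDiff.sum fun w _ => ?_
  split_ifs
  · exact (contDiff_sector (hΦ e)).comp
      ((contDiff_apply ℝ ℝ v).prodMk (contDiff_apply ℝ ℝ w))
  · exact contDiff_const

theorem hasFDerivAt_curvatureMap (hΦ : ∀ e, Φ e ∈ Ioc 0 (Real.pi / 2)) (K : V(G) → ℝ) :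
    HasFDerivAt (curvatureMap Φ) (fderiv ℝ (curvatureMap Φ) K) K :=
  ((contDiff_curvatureMap hΦ (n := 1)).differentiable (by simp) K).hasFDerivAt

theorem contDiff_fderiv_curvatureMap (hΦ : ∀ e, Φ e ∈ Ioc 0 (Real.pi / 2)) :
    ContDiff ℝ 1 (fderiv ℝ (curvatureMap Φ)) :=
  (contDiff_curvatureMap hΦ (n := 2)).fderiv_right (by norm_num)

open scoped Classical in
theorem fderiv_curvatureMap_apply (hΦ : ∀ e, Φ e ∈ Ioc 0 (Real.pi / 2)) (K h : V(G) → ℝ)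
    (v : V(G)) : fderiv ℝ (curvatureMap Φ) K h v = ∑ e : E(G), ∑ w : V(G), if G.IsLink e v w then
      2 * (sectorOff (Φ e) (K v) (K w) + sectorExcess (Φ e) (K v) (K w)) * h v -
        2 * sectorOff (Φ e) (K v) (K w) * h w else 0 := by
  have h1 := hasFDerivAt_pi'.1 (hasFDerivAt_curvatureMap hΦ K) v
  have h2 : HasFDerivAt (fun K => curvatureMap Φ K v) (∑ e : E(G), ∑ w : V(G),
      if G.IsLink e v w then
        ((2 * (sectorOff (Φ e) (K v) (K w) + sectorExcess (Φ e) (K v) (K w))) •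
          ContinuousLinearMap.fst ℝ ℝ ℝ + (2 * -sectorOff (Φ e) (K v) (K w)) •
            ContinuousLinearMap.snd ℝ ℝ ℝ).comp
          ((ContinuousLinearMap.proj (R := ℝ) (φ := fun _ : V(G) => ℝ) v).prod
            (ContinuousLinearMap.proj (R := ℝ) (φ := fun _ : V(G) => ℝ) w)) else 0) K := by
    simp only [curvatureMap_apply hΦ]
    refine HasFDerivAt.fun_sum fun e _ => HasFDerivAt.fun_sum fun w _ => ?_
    split_ifs
    · exact HasFDerivAt.comp (f := fun K : V(G) → ℝ => (K v, K w)) K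
        (hasFDerivAt_sector (hΦ e) (K v, K w))
        ((hasFDerivAt_apply v K).prodMk (hasFDerivAt_apply w K))
    · exact hasFDerivAt_const _ _
  have h3 := DFunLike.congr_fun (h1.unique h2) h
  simp only [ContinuousLinearMap.comp_apply, ContinuousLinearMap.proj_apply] at h3
  rw [h3]
  simp only [sum_apply]
  refine Finset.sum_congr rfl fun e _ => Finset.sum_congr rfl fun w _ => ?_
  split_ifs
  · simp
    ring
  · rfl

-- The double sum runs over both orderings of the ends of `e`, which is what allows edge terms to be
-- symmetrized.
omit [Fintype E(G)] in
open scoped Classical in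
theorem sum_isLink_comm (e : E(G)) (f : V(G) → V(G) → ℝ) :
    (∑ v : V(G), ∑ w : V(G), if G.IsLink e v w then f v w else 0) =
      ∑ v : V(G), ∑ w : V(G), if G.IsLink e v w then f w v else 0 := by
  rw [Finset.sum_comm]
  simp only [Graph.isLink_comm]

open scoped Classical in
theorem fderiv_curvatureMap_dotProduct (hΦ : ∀ e, Φ e ∈ Ioc 0 (Real.pi / 2)) (K a b : V(G) → ℝ) :
    fderiv ℝ (curvatureMap Φ) K a ⬝ᵥ b = ∑ e : E(G), ∑ v : V(G), ∑ w : V(G), if G.IsLink e v w then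
      (2 * (sectorOff (Φ e) (K v) (K w) + sectorExcess (Φ e) (K v) (K w)) * a v -
        2 * sectorOff (Φ e) (K v) (K w) * a w) * b v else 0 := by
  rw [dotProduct, Finset.sum_comm]
  refine Finset.sum_congr rfl fun v _ => ?_
  rw [fderiv_curvatureMap_apply hΦ, Finset.sum_mul]
  simp only [Finset.sum_mul, ite_mul, zero_mul]

theorem fderiv_curvatureMap_symm (hΦ : ∀ e, Φ e ∈ Ioc 0 (Real.pi / 2)) (K a b : V(G) → ℝ) :
    fderiv ℝ (curvatureMap Φ) K a ⬝ᵥ b = fderiv ℝ (curvatureMap Φ) K b ⬝ᵥ a := by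
  classical
  rw [fderiv_curvatureMap_dotProduct hΦ, fderiv_curvatureMap_dotProduct hΦ]
  refine Finset.sum_congr rfl fun e _ => ?_
  rw [← sub_eq_zero]
  have h := sum_isLink_comm e fun v w => 2 * sectorOff (Φ e) (K v) (K w) * a w * b v
  simp only [fun v w => sectorOff_comm (Φ e) (K w) (K v)] at h
  rw [← sub_eq_zero] at h
  rw [← neg_eq_zero, ← h]
  simp only [← Finset.sum_sub_distrib, ← Finset.sum_neg_distrib]
  refine Finset.sum_congr rfl fun v _ => Finset.sum_congr rfl fun w _ => ?_
  split_ifs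
  · ring
  · ring

theorem fderiv_curvatureMap_pos (hΦ : ∀ e, Φ e ∈ Ioc 0 (Real.pi / 2))
    (hV : ∀ v : V(G), ∃ (e : E(G)) (w : V(G)), G.IsLink e v w) (K : V(G) → ℝ) {a : V(G) → ℝ}
    (ha : a ≠ 0) : 0 < fderiv ℝ (curvatureMap Φ) K a ⬝ᵥ a := by
  classical
  have key : fderiv ℝ (curvatureMap Φ) K a ⬝ᵥ a = ∑ e : E(G), ∑ v : V(G), ∑ w : V(G), if G.IsLink e v w then
      2 * sectorExcess (Φ e) (K v) (K w) * a v ^ 2 +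
        sectorOff (Φ e) (K v) (K w) * (a v - a w) ^ 2 else 0 := by
    rw [fderiv_curvatureMap_dotProduct hΦ]
    refine Finset.sum_congr rfl fun e _ => ?_
    -- Swapping the ends replaces half of `2 * a v ^ 2` by `a w ^ 2`, completing the square `(a v -
    -- a w) ^ 2`.
    have h := sum_isLink_comm e fun v w => sectorOff (Φ e) (K v) (K w) * a v ^ 2
    simp only [fun v w => sectorOff_comm (Φ e) (K w) (K v)] at h
    rw [← sub_eq_zero] at h ⊢
    rw [← h]
    simp only [← Finset.sum_sub_distrib]
    refine Finset.sum_congr rfl fun v _ => Finset.sum_congr rfl fun w _ => ?_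
    split_ifs
    · ring
    · ring
  have hnn : ∀ (e : E(G)) (v w : V(G)), 0 ≤ if G.IsLink e v w then
      2 * sectorExcess (Φ e) (K v) (K w) * a v ^ 2 +
        sectorOff (Φ e) (K v) (K w) * (a v - a w) ^ 2 else 0 := by
    intro e v w
    have := sectorExcess_pos (hΦ e) (K v) (K w)
    have := sectorOff_pos (hΦ e) (K v) (K w)
    split_ifs <;> positivity
  obtain ⟨v, hv⟩ := Function.ne_iff.1 ha
  obtain ⟨e, w, hl⟩ := hV v
  rw [key]
  refine Finset.sum_pos' (fun e _ => Finset.sum_nonneg fun v _ => Finset.sum_nonneg fun w _ =>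
    hnn e v w) ⟨e, Finset.mem_univ e, Finset.sum_pos' (fun v _ => Finset.sum_nonneg fun w _ =>
      hnn e v w) ⟨v, Finset.mem_univ v, Finset.sum_pos' (fun w _ => hnn e v w)
        ⟨w, Finset.mem_univ w, ?_⟩⟩⟩
  rw [if_pos hl]
  have h1 := sectorExcess_pos (hΦ e) (K v) (K w)
  have h2 := sectorOff_pos (hΦ e) (K v) (K w)
  have h3 : 0 < a v ^ 2 := by
    have : a v ≠ 0 := hv
    positivity
  positivity

/-- Uniformity in `K` is the point: with the bound on `curvatureMap` it makes the Calabi field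
bounded, hence complete. -/
theorem norm_fderiv_curvatureMap_apply_le (hΦ : ∀ e, Φ e ∈ Ioc 0 (Real.pi / 2))
    (K a : V(G) → ℝ) : ‖fderiv ℝ (curvatureMap Φ) K a‖ ≤
      Fintype.card E(G) * Fintype.card V(G) * 8 * ‖a‖ := by
  classical
  rw [pi_norm_le_iff_of_nonneg (by positivity)]
  intro v
  rw [fderiv_curvatureMap_apply hΦ]
  have h : ∀ (e : E(G)) (w : V(G)), ‖if G.IsLink e v w then
      2 * (sectorOff (Φ e) (K v) (K w) + sectorExcess (Φ e) (K v) (K w)) * a v -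
        2 * sectorOff (Φ e) (K v) (K w) * a w else 0‖ ≤ 8 * ‖a‖ := by
    intro e w
    split_ifs
    · have h1 := sectorExcess_pos (hΦ e) (K v) (K w)
      have h2 := sectorOff_pos (hΦ e) (K v) (K w)
      have h3 := sectorExcess_le_two (hΦ e) (K v) (K w)
      have h4 := sectorOff_le_one (hΦ e) (K v) (K w)
      have h5 := norm_le_pi_norm a v
      have h6 := norm_le_pi_norm a w
      refine (norm_sub_le _ _).trans ?_
      rw [norm_mul _ (a v), norm_mul _ (a w),
        Real.norm_of_nonneg (r := 2 * (_ + _)) (by positivity),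
        Real.norm_of_nonneg (r := 2 * sectorOff _ _ _) (by positivity)]
      have h7 : 2 * (sectorOff (Φ e) (K v) (K w) + sectorExcess (Φ e) (K v) (K w)) * ‖a v‖ ≤
          6 * ‖a‖ := by gcongr; linarith
      have h8 : 2 * sectorOff (Φ e) (K v) (K w) * ‖a w‖ ≤ 2 * ‖a‖ := by gcongr; linarith
      linarith
    · simp
  calc _ ≤ ∑ _e : E(G), ∑ _w : V(G), 8 * ‖a‖ :=
        norm_sum_le_of_le _ fun e _ => norm_sum_le_of_le _ fun w _ => h e w
    _ = _ := by simp; ring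

/-- A coarse count over all pairs `(e, w)`. It gives boundedness, and also decay of `L v` as `K v →
-∞`. -/
theorem curvatureMap_le (hΦ : ∀ e, Φ e ∈ Ioc 0 (Real.pi / 2)) (K : V(G) → ℝ) (v : V(G)) :
    curvatureMap Φ K v ≤
      Fintype.card E(G) * Fintype.card V(G) * (Real.pi * cosRadius (K v)) := by
  classical
  rw [curvatureMap_apply hΦ]
  calc _ ≤ ∑ _e : E(G), ∑ _w : V(G), Real.pi * cosRadius (K v) := by
        refine Finset.sum_le_sum fun e _ => Finset.sum_le_sum fun w _ => ?_
        split_ifs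
        · exact sector_le_pi_mul_cosRadius _ _ _
        · exact mul_nonneg Real.pi_pos.le (cosRadius_pos _).le
    _ = _ := by simp; ring

theorem curvatureMap_nonneg (hΦ : ∀ e, Φ e ∈ Ioc 0 (Real.pi / 2)) (K : V(G) → ℝ) (v : V(G)) :
    0 ≤ curvatureMap Φ K v := by
  classical
  rw [curvatureMap_apply hΦ]
  refine Finset.sum_nonneg fun e _ => Finset.sum_nonneg fun w _ => ?_
  split_ifs
  · exact (sector_pos (hΦ e) _ _).le
  · exact le_rfl

theorem curvatureMap_pos (hΦ : ∀ e, Φ e ∈ Ioc 0 (Real.pi / 2))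
    (hV : ∀ v : V(G), ∃ (e : E(G)) (w : V(G)), G.IsLink e v w) (K : V(G) → ℝ) (v : V(G)) :
    0 < curvatureMap Φ K v := by
  classical
  rw [curvatureMap_apply hΦ]
  have hnn : ∀ (e : E(G)) (w : V(G)),
      0 ≤ if G.IsLink e v w then sector (Φ e) (K v) (K w) else 0 := by
    intro e w
    split_ifs
    · exact (sector_pos (hΦ e) _ _).le
    · exact le_rfl
  obtain ⟨e, w, hl⟩ := hV v
  refine Finset.sum_pos' (fun e _ => Finset.sum_nonneg fun w _ => hnn e w)
    ⟨e, Finset.mem_univ e, Finset.sum_pos' (fun w _ => hnn e w) ⟨w, Finset.mem_univ w, ?_⟩⟩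
  rw [if_pos hl]
  exact sector_pos (hΦ e) _ _

theorem exists_norm_curvatureMap_sub_le (hΦ : ∀ e, Φ e ∈ Ioc 0 (Real.pi / 2)) (p : V(G) → ℝ) :
    ∃ B, ∀ K, ‖curvatureMap Φ K - p‖ ≤ B := by
  refine ⟨Fintype.card E(G) * Fintype.card V(G) * Real.pi + ‖p‖, fun K => ?_⟩
  refine (norm_sub_le _ _).trans (add_le_add_left ?_ _)
  have hπ := Real.pi_pos
  rw [pi_norm_le_iff_of_nonneg (by positivity)]
  intro v
  rw [Real.norm_of_nonneg (curvatureMap_nonneg hΦ K v)]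
  refine (curvatureMap_le hΦ K v).trans ?_
  gcongr
  exact mul_le_of_le_one_right hπ.le (cosRadius_le_one _)

/-! ### The image of the total curvatures -/

open scoped Classical in
/-- The total curvature that the edge `e` contributes to the vertices in `W`. -/
noncomputable def edgeCurvature (Φ : E(G) → ℝ) (K : V(G) → ℝ) (W : Finset V(G)) (e : E(G)) : ℝ :=
  ∑ v ∈ W, ∑ w : V(G), if G.IsLink e v w then sector (Φ e) (K v) (K w) else 0

theorem sum_curvatureMap (hΦ : ∀ e, Φ e ∈ Ioc 0 (Real.pi / 2)) (K : V(G) → ℝ)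
    (W : Finset V(G)) : ∑ v ∈ W, curvatureMap Φ K v = ∑ e, edgeCurvature Φ K W e := by
  simp only [curvatureMap_apply hΦ, edgeCurvature]
  exact Finset.sum_comm

theorem sum_curvatureMap_eq_sum_edgesMeeting (hΦ : ∀ e, Φ e ∈ Ioc 0 (Real.pi / 2))
    (K : V(G) → ℝ) (W : Finset V(G)) :
    ∑ v ∈ W, curvatureMap Φ K v = ∑ e ∈ edgesMeeting W, edgeCurvature Φ K W e := by
  classical
  rw [sum_curvatureMap hΦ]
  refine (Finset.sum_subset (Finset.subset_univ _) fun e _ he => ?_).symm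
  refine Finset.sum_eq_zero fun v hv => Finset.sum_eq_zero fun w _ => if_neg fun hl => he ?_
  simp only [edgesMeeting, Finset.mem_filter, Finset.mem_univ, true_and]
  exact ⟨v, hv, w, hl⟩

omit [Fintype E(G)] in
open scoped Classical in
theorem edgeCurvature_eq [G.Loopless] (K : V(G) → ℝ) (W : Finset V(G)) {e : E(G)} {a b : V(G)}
    (h : G.IsLink e a b) : edgeCurvature Φ K W e =
      (if a ∈ W then sector (Φ e) (K a) (K b) else 0) +
        if b ∈ W then sector (Φ e) (K b) (K a) else 0 := by
  -- Without loops the orderings `(a, b)` and `(b, a)` are distinct, so each end in `W` contributes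
  -- exactly one sector.
  have hab : a ≠ b := fun hab => h.ne (congrArg Subtype.val hab)
  have key : ∀ v w : V(G), (if G.IsLink e v w then sector (Φ e) (K v) (K w) else 0) =
      (if v = a then if w = b then sector (Φ e) (K a) (K b) else 0 else 0) +
        if v = b then if w = a then sector (Φ e) (K b) (K a) else 0 else 0 := by
    intro v w
    have := h.isLink_iff (x' := v) (y' := w)
    simp only [Subtype.coe_inj] at this
    by_cases hl : G.IsLink e v w
    · rw [if_pos hl]
      rcases this.1 hl with ⟨rfl, rfl⟩ | ⟨rfl, rfl⟩
      · simp [hab]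
      · simp [hab.symm]
    · rw [if_neg hl]
      rw [this] at hl
      grind
  have key' : ∀ (c : ℝ) (a b : V(G)), (∑ v ∈ W, ∑ w : V(G), if v = a then if w = b then c else 0
      else 0) = if a ∈ W then c else 0 := by
    intro c a b
    rw [← Finset.sum_ite_eq' W a fun _ => c]
    refine Finset.sum_congr rfl fun v _ => ?_
    split_ifs <;> simp
  simp only [edgeCurvature, key, Finset.sum_add_distrib, key']

omit [Fintype V(G)] [Fintype E(G)] in
theorem exists_isLink (e : E(G)) : ∃ a b : V(G), G.IsLink e a b := by
  obtain ⟨x, y, h⟩ := G.exists_isLink_of_mem_edgeSet e.2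
  exact ⟨⟨x, h.left_mem⟩, ⟨y, h.right_mem⟩, h⟩

omit [Fintype V(G)] in
theorem exists_isLink_of_mem_edgesMeeting {W : Finset V(G)} {e : E(G)} (he : e ∈ edgesMeeting W) :
    ∃ a ∈ W, ∃ b : V(G), G.IsLink e a b := by
  simp only [edgesMeeting, Finset.mem_filter, Finset.mem_univ, true_and] at he
  obtain ⟨a, ha, y, h⟩ := he
  exact ⟨a, ha, ⟨y, h.right_mem⟩, h⟩

omit [Fintype E(G)] in
theorem edgeCurvature_lt [G.Loopless] (hΦ : ∀ e, Φ e ∈ Ioc 0 (Real.pi / 2)) (K : V(G) → ℝ)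
    {W : Finset V(G)} (e : E(G)) : edgeCurvature Φ K W e < 2 * Φ e := by
  classical
  obtain ⟨a, b, h⟩ := exists_isLink e
  rw [edgeCurvature_eq K W h]
  have h1 := sector_add_sector_lt (hΦ e) (K a) (K b)
  have h2 := sector_pos (hΦ e) (K a) (K b)
  have h3 := sector_pos (hΦ e) (K b) (K a)
  split_ifs <;> linarith

theorem sum_curvatureMap_lt [G.Loopless] (hΦ : ∀ e, Φ e ∈ Ioc 0 (Real.pi / 2))
    (hV : ∀ v : V(G), ∃ (e : E(G)) (w : V(G)), G.IsLink e v w) (K : V(G) → ℝ)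
    {W : Finset V(G)} (hW : W.Nonempty) :
    ∑ v ∈ W, curvatureMap Φ K v < 2 * ∑ e ∈ edgesMeeting W, Φ e := by
  rw [sum_curvatureMap_eq_sum_edgesMeeting hΦ, Finset.mul_sum]
  refine Finset.sum_lt_sum_of_nonempty ?_ fun e _ => edgeCurvature_lt hΦ K e
  obtain ⟨v, hv⟩ := hW
  obtain ⟨e, w, hl⟩ := hV v
  refine ⟨e, ?_⟩
  simp only [edgesMeeting, Finset.mem_filter, Finset.mem_univ, true_and]
  exact ⟨v, hv, w, hl⟩

/-- The polytope of the total curvatures of ideal circle patterns. -/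
def curvaturePolytope (Φ : E(G) → ℝ) : Set (V(G) → ℝ) :=
  {p | (∀ v, 0 < p v) ∧
    ∀ W : Finset V(G), W.Nonempty → ∑ v ∈ W, p v < 2 * ∑ e ∈ edgesMeeting W, Φ e}

omit [Fintype V(G)] in
theorem convex_curvaturePolytope (Φ : E(G) → ℝ) : Convex ℝ (curvaturePolytope Φ) := by
  have h1 : Convex ℝ {p : V(G) → ℝ | ∀ v, 0 < p v} := by
    simp only [Set.ofPred_forall]
    exact convex_iInter fun v => convex_halfSpace_gt (ContinuousLinearMap.proj (R := ℝ) v).isLinear _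
  have h2 : Convex ℝ {p : V(G) → ℝ | ∀ W : Finset V(G), W.Nonempty →
      ∑ v ∈ W, p v < 2 * ∑ e ∈ edgesMeeting W, Φ e} := by
    simp only [Set.ofPred_forall]
    refine convex_iInter fun W => convex_iInter fun _ => convex_halfSpace_lt ?_ _
    exact ⟨fun x y => by simp [Finset.sum_add_distrib], fun c x => by simp [Finset.mul_sum]⟩
  exact h1.inter h2

/-- A positive definite derivative is injective, hence surjective in finite dimension, and the map
is locally open. -/
theorem isOpen_range_curvatureMap (hΦ : ∀ e, Φ e ∈ Ioc 0 (Real.pi / 2))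
    (hV : ∀ v : V(G), ∃ (e : E(G)) (w : V(G)), G.IsLink e v w) :
    IsOpen (range (curvatureMap Φ)) := by
  refine IsOpenMap.isOpen_range (isOpenMap_iff_nhds_le.2 fun K => ?_)
  have hs : HasStrictFDerivAt (curvatureMap Φ) (fderiv ℝ (curvatureMap Φ) K) K :=
    (contDiff_curvatureMap hΦ (n := 1)).contDiffAt.hasStrictFDerivAt (by simp)
  refine (hs.map_nhds_eq_of_surj ?_).ge
  refine LinearMap.range_eq_top.2 (LinearMap.injective_iff_surjective.1 ?_)
  refine (injective_iff_map_eq_zero _).2 fun a ha => ?_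
  by_contra h0
  have := fderiv_curvatureMap_pos hΦ hV K h0
  have ha' : fderiv ℝ (curvatureMap Φ) K a = 0 := ha
  simp [ha'] at this

theorem Ultrafilter.exists_le_or_tendsto_atTop {X : Type*} (u : Ultrafilter X) (f : X → ℝ) :
    (∃ m, ∀ᶠ x in u, f x ≤ m) ∨ Tendsto f u atTop := by
  by_cases h : ∃ m, ∀ᶠ x in u, f x ≤ m
  · exact .inl h
  · refine .inr (tendsto_atTop.2 fun m => ?_)
    filter_upwards [Ultrafilter.eventually_not.2 (not_exists.1 h m)] with x hx
    exact (not_le.1 hx).le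

/-- When the radii at `W` shrink to zero and the others stay away from zero, every edge meeting `W`
asymptotically gives its full `2 * Φ e` to `W`, whether one or both ends lie there. -/
theorem exists_tendsto_le_edgeCurvature [G.Loopless] (hΦ : ∀ e, Φ e ∈ Ioc 0 (Real.pi / 2))
    {u : Filter (V(G) → ℝ)} {W : Finset V(G)} (hW : ∀ v ∈ W, Tendsto (fun K : V(G) → ℝ => K v) u atTop)
    (hW' : ∀ v ∉ W, ∃ m, ∀ᶠ K : V(G) → ℝ in u, K v ≤ m) {e : E(G)} (he : e ∈ edgesMeeting W) :
    ∃ ρ : (V(G) → ℝ) → ℝ, Tendsto ρ u (𝓝 (2 * Φ e)) ∧ ∀ᶠ K in u, ρ K ≤ edgeCurvature Φ K W e := by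
  classical
  obtain ⟨a, ha, b, h⟩ := exists_isLink_of_mem_edgesMeeting he
  by_cases hb : b ∈ W
  · refine ⟨fun K => 2 * Φ e * (cosRadius (K a) * cosRadius (K b)), ?_, .of_forall fun K => ?_⟩
    · simpa using ((tendsto_cosRadius_atTop.comp (hW a ha)).mul
        (tendsto_cosRadius_atTop.comp (hW b hb))).const_mul (2 * Φ e)
    · rw [edgeCurvature_eq K W h, if_pos ha, if_pos hb]
      exact mul_cosRadius_le_sector_add_sector (hΦ e) _ _
  · obtain ⟨m, hm⟩ := hW' b hb
    refine ⟨fun K => 2 * (cosRadius (K a) * (Φ e - Real.exp (m - K a))), ?_, ?_⟩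
    · have h1 : Tendsto (fun K : V(G) → ℝ => Real.exp (m - K a)) u (𝓝 0) :=
        Real.tendsto_exp_atBot.comp (tendsto_atBot_add_const_left _ m
          (tendsto_neg_atTop_atBot.comp (hW a ha)))
      simpa using ((tendsto_cosRadius_atTop.comp (hW a ha)).mul (h1.const_sub (Φ e))).const_mul 2
    · filter_upwards [hm] with K hK
      rw [edgeCurvature_eq K W h, if_pos ha, if_neg hb, add_zero]
      refine le_trans ?_ (mul_sub_exp_le_sector (hΦ e) _ _)
      have := (cosRadius_pos (K a)).le
      gcongr

/-- An ultrafilter of parameters whose curvatures tend to `p` sorts the vertices into those with `K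
v → ∞` and those bounded above. The inequality for the first set excludes it, positivity of `p`
bounds `K` below, and compactness yields a preimage. -/
theorem closure_range_curvatureMap_inter_subset [G.Loopless]
    (hΦ : ∀ e, Φ e ∈ Ioc 0 (Real.pi / 2)) :
    closure (range (curvatureMap Φ)) ∩ curvaturePolytope Φ ⊆ range (curvatureMap Φ) := by
  classical
  rintro p ⟨hcl, hpos, hsum⟩
  have : (comap (curvatureMap Φ) (𝓝 p)).NeBot := by
    rw [comap_neBot_iff_frequently]
    exact mem_closure_iff_frequently.1 hcl
  set u := Ultrafilter.of (comap (curvatureMap Φ) (𝓝 p))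
  have hu : Tendsto (curvatureMap Φ) u (𝓝 p) := tendsto_iff_comap.2 (Ultrafilter.of_le _)
  have huv : ∀ v, Tendsto (fun K => curvatureMap Φ K v) u (𝓝 (p v)) := fun v =>
    ((continuous_apply v).tendsto _).comp hu
  set W : Finset V(G) := Finset.univ.filter fun v => Tendsto (fun K : V(G) → ℝ => K v) u atTop with hWdef
  have hW : ∀ v ∈ W, Tendsto (fun K : V(G) → ℝ => K v) u atTop := fun v hv => (Finset.mem_filter.1 hv).2
  have hW' : ∀ v ∉ W, ∃ m, ∀ᶠ K : V(G) → ℝ in u, K v ≤ m := fun v hv =>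
    (Ultrafilter.exists_le_or_tendsto_atTop u fun K : V(G) → ℝ => K v).resolve_right fun h =>
      hv (Finset.mem_filter.2 ⟨Finset.mem_univ v, h⟩)
  have hWe : ¬ W.Nonempty := by
    intro hne
    choose! ρ hρ hle using fun e (he : e ∈ edgesMeeting W) =>
      exists_tendsto_le_edgeCurvature hΦ hW hW' he
    have h1 := tendsto_finsetSum _ hρ
    have h2 := tendsto_finsetSum W fun v _ => huv v
    have h3 : 2 * ∑ e ∈ edgesMeeting W, Φ e ≤ ∑ v ∈ W, p v := by
      rw [Finset.mul_sum]
      refine le_of_tendsto_of_tendsto h1 h2 ?_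
      filter_upwards [(Filter.eventually_all_finset _).2 hle] with K hK
      rw [sum_curvatureMap_eq_sum_edgesMeeting hΦ]
      exact Finset.sum_le_sum hK
    exact absurd (hsum W hne) (not_lt.2 h3)
  have hup : ∀ v, ∃ m, ∀ᶠ K : V(G) → ℝ in u, K v ≤ m := fun v => hW' v fun hv => hWe ⟨v, hv⟩
  have hlow : ∀ v, ∃ m, ∀ᶠ K : V(G) → ℝ in u, m ≤ K v := by
    intro v
    have hπ := Real.pi_pos
    -- `L v ≤ N * exp (K v)`, and eventually `L v > p v / 2`; the `+ 1` keeps `N` positive.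
    set N : ℝ := Fintype.card E(G) * Fintype.card V(G) * Real.pi + 1
    have hN : 0 < N := by positivity
    refine ⟨Real.log (p v / 2 / N), ?_⟩
    filter_upwards [(huv v).eventually (lt_mem_nhds (half_lt_self (hpos v)))] with K hK
    have hp := hpos v
    rw [Real.log_le_iff_le_exp (by positivity), div_le_iff₀ hN]
    have h1 := curvatureMap_le hΦ K v
    have h2 := cosRadius_le_exp (K v)
    have h3 : (Fintype.card E(G) : ℝ) * Fintype.card V(G) * (Real.pi * cosRadius (K v)) ≤
        Fintype.card E(G) * Fintype.card V(G) * (Real.pi * Real.exp (K v)) := by gcongr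
    have h4 := Real.exp_pos (K v)
    have h5 : Real.exp (K v) * N =
        Fintype.card E(G) * Fintype.card V(G) * (Real.pi * Real.exp (K v)) + Real.exp (K v) := by
      ring
    linarith
  choose M hM using hup
  choose m hm using hlow
  have hIcc : Icc m M ∈ u := by
    filter_upwards [eventually_all.2 hM, eventually_all.2 hm] with K h1 h2
    exact ⟨h2, h1⟩
  obtain ⟨K, -, hK⟩ := isCompact_Icc.ultrafilter_le_nhds' u hIcc
  have h1 : Tendsto (curvatureMap Φ) u (𝓝 (curvatureMap Φ K)) :=
    ((contDiff_curvatureMap hΦ (n := 0)).continuous.tendsto K).mono_left hK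
  exact ⟨K, tendsto_nhds_unique h1 hu⟩

theorem range_curvatureMap [G.Loopless] (hΦ : ∀ e, Φ e ∈ Ioc 0 (Real.pi / 2))
    (hV : ∀ v : V(G), ∃ (e : E(G)) (w : V(G)), G.IsLink e v w) :
    range (curvatureMap Φ) = curvaturePolytope Φ := by
  have hsub : range (curvatureMap Φ) ⊆ curvaturePolytope Φ := by
    rintro _ ⟨K, rfl⟩
    exact ⟨curvatureMap_pos hΦ hV K, fun W hW => sum_curvatureMap_lt hΦ hV K hW⟩
  refine hsub.antisymm ?_
  exact (convex_curvaturePolytope Φ).isPreconnected.subset_of_closure_inter_subset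
    (isOpen_range_curvatureMap hΦ hV)
    ⟨curvatureMap Φ 0, hsub (mem_range_self 0), mem_range_self 0⟩
    (closure_range_curvatureMap_inter_subset hΦ)

end Curvature

/-! ### Closed 2-cell embeddings have no isolated vertices -/

/-- Every point of a surface has arbitrarily small connected punctured neighbourhoods. -/
theorem exists_isPreconnected_punctured {S : Type*} [TopologicalSpace S]
    [ChartedSpace (EuclideanSpace ℝ (Fin 2)) S] {x : S} {N : Set S} (hN : N ∈ 𝓝 x) :
    ∃ U ⊆ N \ {x}, U.Nonempty ∧ IsPreconnected U ∧ x ∈ closure U := by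
  set φ := chartAt (EuclideanSpace ℝ (Fin 2)) x
  have hx : x ∈ φ.source := mem_chart_source _ x
  have hc : φ x ∈ φ.target := φ.map_source hx
  have hsymm : ContinuousAt φ.symm (φ x) := φ.symm.continuousAt hc
  have hmem : φ.target ∩ φ.symm ⁻¹' N ∈ 𝓝 (φ x) :=
    inter_mem (φ.open_target.mem_nhds hc) (hsymm.preimage_mem_nhds (by rwa [φ.left_inv hx]))
  obtain ⟨ε, hε, hball⟩ := Metric.mem_nhds_iff.1 hmem
  -- Polar coordinates exhibit the punctured disk as a continuous image of an interval times a
  -- circle, both connected.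
  set f : ℝ × EuclideanSpace ℝ (Fin 2) → EuclideanSpace ℝ (Fin 2) := fun p => φ x + p.1 • p.2
  set B : Set (ℝ × EuclideanSpace ℝ (Fin 2)) := Ioo 0 ε ×ˢ Metric.sphere 0 1
  have hf : Continuous f := by fun_prop
  have hfB : ∀ p ∈ B, f p ∈ Metric.ball (φ x) ε ∧ f p ≠ φ x := by
    rintro ⟨r, u⟩ ⟨hr, hu⟩
    have hu1 : ‖u‖ = 1 := by simpa using hu
    refine ⟨?_, fun h => ?_⟩
    · simp [f, norm_smul, hu1, abs_of_pos hr.1, hr.2]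
    · have : r • u = 0 := by simpa [f] using h
      rcases smul_eq_zero.1 this with h | h
      · exact hr.1.ne' h
      · simp [h] at hu1
  have hsphere : IsConnected (Metric.sphere (0 : EuclideanSpace ℝ (Fin 2)) 1) := by
    refine isConnected_sphere ?_ 0 zero_le_one
    rw [← Module.finrank_eq_rank, finrank_euclideanSpace_fin]
    norm_num
  obtain ⟨u, hu⟩ := hsphere.nonempty
  have hB : IsPreconnected B := isPreconnected_Ioo.prod hsphere.isPreconnected
  have hcont : ContinuousOn (φ.symm ∘ f) B :=
    φ.symm.continuousOn.comp hf.continuousOn fun p hp => (hball (hfB p hp).1).1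
  refine ⟨(φ.symm ∘ f) '' B, ?_, ?_, hB.image _ hcont, ?_⟩
  · rintro _ ⟨p, hp, rfl⟩
    have h := hball (hfB p hp).1
    refine ⟨h.2, fun h' => (hfB p hp).2 ?_⟩
    rw [← φ.right_inv h.1]
    exact congrArg φ h'
  · exact ⟨_, mem_image_of_mem _ (show (ε / 2, u) ∈ B from ⟨⟨by linarith, by linarith⟩, hu⟩)⟩
  · have h0 : f (0, u) = φ x := by simp [f]
    have ht : Tendsto (fun r : ℝ => (φ.symm ∘ f) (r, u)) (𝓝[>] 0) (𝓝 x) := by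
      have h1 : ContinuousAt (fun r : ℝ => (φ.symm ∘ f) (r, u)) 0 := by
        refine ContinuousAt.comp (f := fun r : ℝ => f (r, u)) (by rwa [h0]) ?_
        exact (hf.comp (by fun_prop : Continuous fun r : ℝ => (r, u))).continuousAt
      have h2 := h1.tendsto
      simp only [Function.comp_apply, h0, φ.left_inv hx] at h2
      exact h2.mono_left nhdsWithin_le_nhds
    refine mem_closure_of_tendsto ht ?_
    filter_upwards [Ioo_mem_nhdsGT hε] with r hr
    exact mem_image_of_mem _ (show (r, u) ∈ B from ⟨hr, hu⟩)

namespace GraphEmbedding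

variable {α β : Type*} {G : Graph α β} {S : Type*} [TopologicalSpace S]

theorem exists_isLink_of_mem_range_edge (η : GraphEmbedding G S) {v : V(G)} {e : E(G)}
    (h : η.vert v ∈ range (η.edge e)) : ∃ w : V(G), G.IsLink e v w := by
  obtain ⟨s, hs⟩ := h
  obtain ⟨a, b, hl, h0, h1⟩ := η.edge_ends e
  by_cases hs0 : s = 0
  · obtain rfl := η.vert_injective (h0.symm.trans (hs0 ▸ hs))
    exact ⟨b, hl⟩
  by_cases hs1 : s = 1
  · obtain rfl := η.vert_injective (h1.symm.trans (hs1 ▸ hs))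
    exact ⟨a, hl.symm⟩
  exact absurd hs (η.edge_ne_vert e s
    ⟨unitInterval.pos_iff_ne_zero.2 hs0, unitInterval.lt_one_iff_ne_one.2 hs1⟩ v)

/-- A connected punctured neighbourhood of an isolated vertex lies in one face, so the vertex is on
the frontier of that face. That frontier is a union of edges, none of which contains the vertex. -/
theorem IsClosedTwoCell.exists_isLink [T2Space S] [ChartedSpace (EuclideanSpace ℝ (Fin 2)) S]
    [Finite V(G)] [Finite E(G)] {η : GraphEmbedding G S} (hη : η.IsClosedTwoCell) (v : V(G)) :
    ∃ (e : E(G)) (w : V(G)), G.IsLink e v w := by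
  by_contra! hiso
  have hedge : ∀ e, η.vert v ∉ range (η.edge e) := fun e he =>
    let ⟨w, hw⟩ := η.exists_isLink_of_mem_range_edge he
    hiso e w hw
  set A : Set S := η.vert '' {v}ᶜ ∪ ⋃ e, range (η.edge e) with hA
  have hAc : IsClosed A :=
    ((Set.toFinite _).isClosed).union
      (isClosed_iUnion_of_finite fun e => (isCompact_range (η.edge e).continuous).isClosed)
  have hvA : η.vert v ∉ A := by
    rintro (⟨w, hw, h⟩ | h)
    · exact hw (η.vert_injective h)
    · obtain ⟨e, he⟩ := mem_iUnion.1 h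
      exact hedge e he
  obtain ⟨U, hUA, ⟨y, hy⟩, hU, hcl⟩ :=
    exists_isPreconnected_punctured (hAc.isOpen_compl.mem_nhds hvA)
  have hUim : U ⊆ η.imageᶜ := by
    rintro z hz (⟨w, rfl⟩ | h)
    · by_cases hwv : w = v
      · exact (hUA hz).2 (by rw [hwv]; rfl)
      · exact (hUA hz).1 (.inl (mem_image_of_mem _ hwv))
    · exact (hUA hz).1 (.inr h)
  set f := connectedComponentIn η.imageᶜ y
  have hface : η.IsFace f := ⟨y, hUim hy, rfl⟩
  have hvf : η.vert v ∈ frontier f := by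
    refine ⟨closure_mono (hU.subset_connectedComponentIn hy hUim) hcl, fun h => ?_⟩
    exact connectedComponentIn_subset _ _ (interior_subset h) (.inl (mem_range_self v))
  obtain ⟨γ, E, -, -, hfr⟩ := hη.boundary_curve f hface
  rw [hfr] at hvf
  obtain ⟨e, -, he⟩ := mem_iUnion₂.1 hvf
  exact hedge e he

end GraphEmbedding

/-! ### The flows in logarithmic coordinates -/

section Flows

variable {α β : Type*} {G : Graph α β} [Fintype V(G)] [Fintype E(G)] {Φ : E(G) → ℝ}

open scoped Classical in
theorem jacobi_apply (hΦ : ∀ e, Φ e ∈ Ioc 0 (Real.pi / 2)) (K : V(G) → ℝ)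
    (v w : V(G)) : jacobi Φ K v w = fderiv ℝ (curvatureMap Φ) K (Pi.single w 1) v := by
  have h1 : HasFDerivAt (curvatureMap Φ) (fderiv ℝ (curvatureMap Φ) K)
      (Function.update K w (K w)) := by
    rw [Function.update_eq_self]
    exact hasFDerivAt_curvatureMap hΦ K
  have h2 := hasDerivAt_pi.1 (h1.comp_hasDerivAt (K w) (hasDerivAt_update K w (K w))) v
  exact h2.deriv

/-- Symmetry of the Jacobian removes the transpose, which puts the flow in descent form with `M =
J`. -/
theorem calabiField_eq (hΦ : ∀ e, Φ e ∈ Ioc 0 (Real.pi / 2)) (Lhat K : V(G) → ℝ) :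
    calabiField Φ Lhat K = -fderiv ℝ (curvatureMap Φ) K (curvatureMap Φ K - Lhat) := by
  classical
  rw [calabiField]
  congr 1
  funext v
  have h := fderiv_curvatureMap_symm hΦ K (curvatureMap Φ K - Lhat) (Pi.single v 1)
  rw [dotProduct_single_one] at h
  rw [h]
  simp only [Matrix.mulVec, dotProduct, Matrix.transpose_apply, jacobi_apply hΦ]
  rfl

theorem contDiff_calabiField (hΦ : ∀ e, Φ e ∈ Ioc 0 (Real.pi / 2)) (Lhat : V(G) → ℝ) :
    ContDiff ℝ 1 (calabiField Φ Lhat) := by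
  rw [funext (calabiField_eq hΦ Lhat)]
  exact ((contDiff_fderiv_curvatureMap hΦ).clm_apply
    ((contDiff_curvatureMap hΦ (n := 1)).sub contDiff_const)).neg

theorem exists_norm_calabiField_le (hΦ : ∀ e, Φ e ∈ Ioc 0 (Real.pi / 2)) (Lhat : V(G) → ℝ) :
    ∃ B, ∀ K, ‖calabiField Φ Lhat K‖ ≤ B := by
  obtain ⟨B, hB⟩ := exists_norm_curvatureMap_sub_le hΦ Lhat
  refine ⟨Fintype.card E(G) * Fintype.card V(G) * 8 * B, fun K => ?_⟩
  rw [calabiField_eq hΦ, norm_neg]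
  refine (norm_fderiv_curvatureMap_apply_le hΦ K _).trans ?_
  gcongr
  exact hB K

theorem calabiField_eq_zero_iff (hΦ : ∀ e, Φ e ∈ Ioc 0 (Real.pi / 2))
    (hV : ∀ v : V(G), ∃ (e : E(G)) (w : V(G)), G.IsLink e v w) {Lhat K : V(G) → ℝ} :
    calabiField Φ Lhat K = 0 ↔ curvatureMap Φ K = Lhat := by
  rw [calabiField_eq hΦ, neg_eq_zero]
  refine ⟨fun h => ?_, fun h => by rw [h, sub_self, map_zero]⟩
  by_contra hne
  have := fderiv_curvatureMap_pos hΦ hV K (sub_ne_zero.2 hne)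
  rw [h, zero_dotProduct] at this
  exact this.false

theorem injective_curvatureMap (hΦ : ∀ e, Φ e ∈ Ioc 0 (Real.pi / 2))
    (hV : ∀ v : V(G), ∃ (e : E(G)) (w : V(G)), G.IsLink e v w) :
    Function.Injective (curvatureMap Φ) :=
  injective_of_posDef_fderiv (hasFDerivAt_curvatureMap hΦ) fun K _ ha =>
    fderiv_curvatureMap_pos hΦ hV K ha

theorem hasFDerivAt_curvatureMap_sub (hΦ : ∀ e, Φ e ∈ Ioc 0 (Real.pi / 2)) (Lhat K : V(G) → ℝ) :
    HasFDerivAt (fun K => curvatureMap Φ K - Lhat) (fderiv ℝ (curvatureMap Φ) K) K :=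
  (hasFDerivAt_curvatureMap hΦ K).sub_const Lhat

theorem exists_norm_sub_le_exp_of_calabi (hΦ : ∀ e, Φ e ∈ Ioc 0 (Real.pi / 2))
    (hV : ∀ v : V(G), ∃ (e : E(G)) (w : V(G)), G.IsLink e v w) {Lhat p : V(G) → ℝ}
    (hp : curvatureMap Φ p = Lhat) {K : ℝ → V(G) → ℝ}
    (hK : IsSolutionOn (calabiField Φ Lhat) univ (Ici 0) K) :
    ∃ C c : ℝ, 0 < c ∧ ∀ t ≥ 0, ‖K t - p‖ ≤ C * Real.exp (-c * t) := by
  have hJ := (contDiff_fderiv_curvatureMap hΦ).continuous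
  have hpos := fun K a => fderiv_curvatureMap_pos hΦ hV K (a := a)
  refine exists_norm_sub_le_exp_of_descent (hasFDerivAt_curvatureMap_sub hΦ Lhat) hJ
    (fderiv_curvatureMap_symm hΦ) hpos hJ hpos (sub_eq_zero.2 hp) fun t ht => ?_
  rw [← calabiField_eq hΦ]
  exact (hK t ht).2

theorem tendsto_of_norm_sub_le_exp {ι : Type*} [Fintype ι] {x : ℝ → ι → ℝ} {p : ι → ℝ}
    (h : ∃ C c : ℝ, 0 < c ∧ ∀ t ≥ 0, ‖x t - p‖ ≤ C * Real.exp (-c * t)) :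
    Tendsto x atTop (𝓝 p) := by
  obtain ⟨C, c, hc, h⟩ := h
  rw [tendsto_iff_norm_sub_tendsto_zero]
  have h1 : Tendsto (fun t => C * Real.exp (-c * t)) atTop (𝓝 0) := by
    simpa using (Real.tendsto_exp_atBot.comp
      (tendsto_id.const_mul_atTop_of_neg (neg_lt_zero.2 hc))).const_mul C
  refine squeeze_zero' (.of_forall fun t => norm_nonneg _) ?_ h1
  filter_upwards [eventually_ge_atTop 0] with t ht
  exact h t ht

theorem hasDerivAt_log_cot {r : ℝ} (hr : r ∈ Ioo 0 (Real.pi / 2)) :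
    HasDerivAt (fun r => Real.log (Real.cot r)) (-(2 / Real.sin (2 * r))) r := by
  have hs : Real.sin r ≠ 0 :=
    (Real.sin_pos_of_pos_of_lt_pi hr.1 (by linarith [hr.2, Real.pi_pos])).ne'
  have hc : Real.cos r ≠ 0 :=
    (Real.cos_pos_of_mem_Ioo ⟨by linarith [hr.1, Real.pi_pos], hr.2⟩).ne'
  have h := ((Real.hasDerivAt_cos r).div (Real.hasDerivAt_sin r) hs).log (div_ne_zero hc hs)
  have heq : (fun r => Real.log (Real.cot r)) =
      fun r => Real.log ((Real.cos / Real.sin) r) := by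
    funext r
    rw [Real.cot_eq_cos_div_sin, Pi.div_apply]
  rw [heq]
  refine h.congr_deriv ?_
  rw [Real.sin_two_mul, Pi.div_apply]
  field_simp
  linear_combination -Real.sin_sq_add_cos_sq r

theorem hasDerivAt_arctan_exp_neg (k : ℝ) :
    HasDerivAt (fun k => Real.arctan (Real.exp (-k)))
      (-(Real.sin (2 * Real.arctan (Real.exp (-k))) / 2)) k := by
  have h := ((hasDerivAt_neg k).exp).arctan
  refine h.congr_deriv ?_
  rw [Real.sin_two_mul, Real.sin_arctan, Real.cos_arctan]
  have h2 : √(1 + Real.exp (-k) ^ 2) * √(1 + Real.exp (-k) ^ 2) = 1 + Real.exp (-k) ^ 2 :=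
    Real.mul_self_sqrt (by positivity)
  rw [mul_assoc, div_mul_div_comm, h2]
  ring

/-- The prescribed curvature flow is the descent flow of the total curvatures in the logarithmic
coordinates. -/
theorem isSolutionOn_logCot {Lhat : V(G) → ℝ} {r : ℝ → V(G) → ℝ}
    (hr : IsSolutionOn (curvatureField Φ Lhat) (radiiDomain G) (Ici 0) r) :
    IsSolutionOn (fun K => -(curvatureMap Φ K - Lhat)) univ (Ici 0) fun t => logCot (r t) := by
  intro t ht
  obtain ⟨hD, hd⟩ := hr t ht
  refine ⟨mem_univ _, hasDerivWithinAt_pi.2 fun v => ?_⟩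
  have h := (hasDerivAt_log_cot (hD v)).comp_hasDerivWithinAt t (hasDerivWithinAt_pi.1 hd v)
  refine h.congr_deriv ?_
  have hs : Real.sin (2 * r t v) ≠ 0 :=
    (Real.sin_pos_of_pos_of_lt_pi (by linarith [(hD v).1]) (by linarith [(hD v).2])).ne'
  simp only [curvatureField, Pi.neg_apply, Pi.sub_apply, curvatureMap, radiusOf_logCot hD]
  field_simp

theorem isSolutionOn_radiusOf {Lhat : V(G) → ℝ} {K : ℝ → V(G) → ℝ}
    (hK : IsSolutionOn (fun K => -(curvatureMap Φ K - Lhat)) univ (Ici 0) K) :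
    IsSolutionOn (curvatureField Φ Lhat) (radiiDomain G) (Ici 0) fun t => radiusOf (K t) := by
  intro t ht
  refine ⟨radiusOf_mem (K t), hasDerivWithinAt_pi.2 fun v => ?_⟩
  have h := (hasDerivAt_arctan_exp_neg (K t v)).comp_hasDerivWithinAt t
    (hasDerivWithinAt_pi.1 (hK t ht).2 v)
  refine h.congr_deriv ?_
  simp only [curvatureField, Pi.neg_apply, Pi.sub_apply, curvatureMap]
  simp only [radiusOf]
  ring

theorem continuous_radiusOf {ι : Type*} : Continuous (radiusOf : (ι → ℝ) → ι → ℝ) := by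
  unfold radiusOf
  fun_prop

theorem continuousAt_logCot {ι : Type*} {r : ι → ℝ} (hr : ∀ v, r v ∈ Ioo 0 (Real.pi / 2)) :
    ContinuousAt logCot r :=
  continuousAt_pi.2 fun v =>
    ContinuousAt.comp (f := fun r : ι → ℝ => r v) (hasDerivAt_log_cot (hr v)).continuousAt
      (continuous_apply v).continuousAt

theorem calabi_flowConverges_iff (hΦ : ∀ e, Φ e ∈ Ioc 0 (Real.pi / 2))
    (hV : ∀ v : V(G), ∃ (e : E(G)) (w : V(G)), G.IsLink e v w) (Lhat : V(G) → ℝ) :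
    FlowConverges (calabiField Φ Lhat) univ ↔ Lhat ∈ range (curvatureMap Φ) := by
  obtain ⟨B, hB⟩ := exists_norm_calabiField_le hΦ Lhat
  have hC := contDiff_calabiField hΦ Lhat
  constructor
  · intro h
    obtain ⟨⟨K, hK, h0⟩, hlim⟩ := h 0 (mem_univ _)
    obtain ⟨y, -, hy⟩ := hlim K hK h0
    exact ⟨y, (calabiField_eq_zero_iff hΦ hV).1 (eq_zero_of_tendsto_of_isSolutionOn
      hC.continuous.continuousAt (fun t ht => (hK t ht).2) hy)⟩
  · rintro ⟨p, hp⟩ K₀ -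
    refine ⟨?_, fun K hK _ => ⟨p, mem_univ _, tendsto_of_norm_sub_le_exp
      (exists_norm_sub_le_exp_of_calabi hΦ hV hp hK)⟩⟩
    obtain ⟨K, hK, h0⟩ := exists_isSolution hC hB K₀
    exact ⟨K, fun t _ => ⟨mem_univ _, (hK t).hasDerivWithinAt⟩, h0⟩

theorem curvature_flowConverges_iff (hΦ : ∀ e, Φ e ∈ Ioc 0 (Real.pi / 2))
    (hV : ∀ v : V(G), ∃ (e : E(G)) (w : V(G)), G.IsLink e v w) (Lhat : V(G) → ℝ) :
    FlowConverges (curvatureField Φ Lhat) (radiiDomain G) ↔ Lhat ∈ range (curvatureMap Φ) := by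
  obtain ⟨B, hB⟩ := exists_norm_curvatureMap_sub_le hΦ Lhat
  have hC : ContDiff ℝ 1 fun K => -(curvatureMap Φ K - Lhat) :=
    ((contDiff_curvatureMap hΦ (n := 1)).sub contDiff_const).neg
  have hex : ∀ r₀ ∈ radiiDomain G, ∃ r,
      IsSolutionOn (curvatureField Φ Lhat) (radiiDomain G) (Ici 0) r ∧ r 0 = r₀ := by
    intro r₀ hr₀
    obtain ⟨K, hK, h0⟩ := exists_isSolution hC (fun K => (norm_neg _).trans_le (hB K)) (logCot r₀)
    refine ⟨fun t => radiusOf (K t), isSolutionOn_radiusOf fun t _ =>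
      ⟨mem_univ _, (hK t).hasDerivWithinAt⟩, ?_⟩
    simp only [h0, radiusOf_logCot hr₀]
  constructor
  · intro h
    obtain ⟨⟨r, hr, h0⟩, hlim⟩ := h (radiusOf 0) (radiusOf_mem 0)
    obtain ⟨y, hyD, hy⟩ := hlim r hr h0
    refine ⟨logCot y, ?_⟩
    have := eq_zero_of_tendsto_of_isSolutionOn (X := fun K => -(curvatureMap Φ K - Lhat))
      hC.continuous.continuousAt (fun t ht => (isSolutionOn_logCot hr t ht).2)
      ((continuousAt_logCot hyD).tendsto.comp hy)
    exact sub_eq_zero.1 (neg_eq_zero.1 this)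
  · rintro ⟨p, hp⟩ r₀ hr₀
    refine ⟨hex r₀ hr₀, fun r hr _ => ⟨radiusOf p, radiusOf_mem p, ?_⟩⟩
    have h1 : Tendsto (fun t => logCot (r t)) atTop (𝓝 p) := by
      refine tendsto_of_norm_sub_le_exp (exists_norm_sub_le_exp_of_descent
        (hasFDerivAt_curvatureMap_sub hΦ Lhat) (contDiff_fderiv_curvatureMap hΦ).continuous
        (fderiv_curvatureMap_symm hΦ) (fun K a => fderiv_curvatureMap_pos hΦ hV K (a := a))
        -- In logarithmic coordinates this is the plain gradient flow of the potential.
        (M := fun _ => ContinuousLinearMap.id ℝ _) continuous_const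
        (fun _ h hh => dotProduct_self_pos hh) (sub_eq_zero.2 hp) fun t ht => ?_)
      exact (isSolutionOn_logCot hr t ht).2
    refine ((continuous_radiusOf.tendsto p).comp h1).congr' ?_
    filter_upwards [eventually_ge_atTop 0] with t ht
    exact radiusOf_logCot (hr t ht).1

end Flows

theorem mainTheorem1 {S : Type*} [TopologicalSpace S] [T2Space S] [CompactSpace S]
    [ChartedSpace (EuclideanSpace ℝ (Fin 2)) S]
    {α β : Type*} (G : Graph α β) [G.Loopless] [Fintype V(G)] [Fintype E(G)]
    (η : GraphEmbedding G S) (hη : η.IsClosedTwoCell)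
    (Φ : E(G) → ℝ) (hΦ : ∀ e, Φ e ∈ Ioc 0 (Real.pi / 2))
    (Lhat : V(G) → ℝ) (hLhat : ∀ v, 0 < Lhat v) :
    -- the combinatorial Calabi flow exists for all time
    (∀ K₀ : V(G) → ℝ, ∃! K : ℝ → V(G) → ℝ,
      IsSolutionOn (calabiField Φ Lhat) univ univ K ∧ K 0 = K₀) ∧
    -- the three equivalent statements
    List.TFAE [
      FlowConverges (calabiField Φ Lhat) univ,
      FlowConverges (curvatureField Φ Lhat) (radiiDomain G),
      ∀ W : Finset V(G), W.Nonempty → ∑ v ∈ W, Lhat v < 2 * ∑ e ∈ edgesMeeting W, Φ e] ∧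
    -- exponential convergence to the unique ideal circle pattern with `L = L̂`
    (∀ K : ℝ → V(G) → ℝ, IsSolutionOn (calabiField Φ Lhat) univ (Ici 0) K →
      (∃ y, Tendsto K atTop (𝓝 y)) →
      ∃ r ∈ radiiDomain G, totalCurvature Φ r = Lhat ∧
        (∀ r' ∈ radiiDomain G, totalCurvature Φ r' = Lhat → r' = r) ∧
        ∃ C c : ℝ, 0 < c ∧ ∀ t ≥ 0, ‖K t - logCot r‖ ≤ C * Real.exp (-c * t)) := by
  have hV := hη.exists_isLink
  refine ⟨fun K₀ => ?_, ?_, fun K hK hlim => ?_⟩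
  · obtain ⟨B, hB⟩ := exists_norm_calabiField_le hΦ Lhat
    obtain ⟨K, hK, h0⟩ := exists_isSolution (contDiff_calabiField hΦ Lhat) hB K₀
    refine ⟨K, ⟨fun t _ => ⟨mem_univ _, (hK t).hasDerivWithinAt⟩, h0⟩, fun K' hK' => ?_⟩
    exact eq_of_isSolution (contDiff_calabiField hΦ Lhat)
      (fun t => (hK'.1 t (mem_univ t)).2.hasDerivAt univ_mem) hK (hK'.2.trans h0.symm)
  · have h3 : Lhat ∈ range (curvatureMap Φ) ↔
        ∀ W : Finset V(G), W.Nonempty → ∑ v ∈ W, Lhat v < 2 * ∑ e ∈ edgesMeeting W, Φ e := by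
      rw [range_curvatureMap hΦ hV]
      -- Positivity of `Lhat` is the other half of membership in the polytope.
      exact and_iff_right hLhat
    tfae_have 1 ↔ 3 := (calabi_flowConverges_iff hΦ hV Lhat).trans h3
    tfae_have 2 ↔ 3 := (curvature_flowConverges_iff hΦ hV Lhat).trans h3
    tfae_finish
  · obtain ⟨y, hy⟩ := hlim
    have hLy := (calabiField_eq_zero_iff hΦ hV).1 (eq_zero_of_tendsto_of_isSolutionOn
      (contDiff_calabiField hΦ Lhat).continuous.continuousAt (fun t ht => (hK t ht).2) hy)
    refine ⟨radiusOf y, radiusOf_mem y, hLy, fun r' hr' hL' => ?_, ?_⟩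
    · have h : curvatureMap Φ (logCot r') = curvatureMap Φ y := by
        rw [hLy, curvatureMap, radiusOf_logCot hr', hL']
      rw [← injective_curvatureMap hΦ hV h, radiusOf_logCot hr']
    · rw [logCot_radiusOf]
      exact exists_norm_sub_le_exp_of_calabi hΦ hV hLy hK
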